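/- **Theorem (Besicovitch–Federer projection theorem for measures).** Let $0<m<n$ be integers, let $\mu$ be a finite Borel measure on $\mathbb{R}^n$, and let $\Sigma\subset \mathrm{Gr}(n,m)$ be a Borel subset of the Grassmannian of $m$-dimensional linear subspaces of $\mathbb{R}^n$. Let $\gamma_{n,m}$ be the rotation invariant probability measure on $\mathrm{Gr}(n,m)$. For $V\in\mathrm{Gr}(n,m)$ let $\pi_V\colon\mathbb{R}^n\to V$ be the orthogonal projection, $\pi_V\mu$ the push-forward of $\mu$, and let $\mu=\mu_{V,y}\otimes\pi_V\mu$ be the disintegration of $\mu$ with respect to $\pi_V$, i.e. $(\mu_{V,y})_{y\in V}$ is a Borel family of probability measures on $\mathbb{R}^n$ with $\mu(B)=\int_V\mu_{V,y}(B)\,d(\pi_V\mu)(y)$ for every Borel set $B\subset\mathbb{R}^n$ and with $\mu_{V,y}$ concentrated on $\pi_V^{-1}(y)$ for $\pi_V\mu$-a.e. $y$. Assume that for $\gamma_{n,m}$-a.e. $V\in\Sigma$ $$\mu_{V,y}\ \text{ is purely atomic (concentrated on a countable set) for } \mathcal{H}^m\text{-a.e. } y\in V,$$ for some version of the disintegration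 (which is unique only up to $\pi_V\mu$-null sets of $y$). Then there are Borel measures $\mu_r,\mu_u$ on $\mathbb{R}^n$, mutually singular, with $$\mu=\mu_r+\mu_u,$$ such that * $\mu_r$ is $m$-rectifiable: it is finite, $\mu_r\ll\mathcal{H}^m$, and $\mu_r(\mathbb{R}^n\setminus R)=0$ for some Borel set $R=\bigcup_{i=1}^\infty f_i(E_i)$ with $E_i\subset\mathbb{R}^m$ bounded and $f_i\colon E_i\to\mathbb{R}^n$ Lipschitz; * $\pi_V\mu_u\perp\mathcal{H}^m$ for $\gamma_{n,m}$-a.e. $V\in\Sigma$. -/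

import Mathlib

open MeasureTheory ProbabilityTheory Set Filter Topology
open scoped MeasureTheory ENNReal

noncomputable section

namespace BesicovitchFederer

/-- Euclidean space `ℝⁿ`. -/
abbrev E (n : ℕ) : Type := EuclideanSpace ℝ (Fin n)

/-! ### The Grassmannian and its rotation invariant probability measure -/

/-- The Grassmannian `Gr(n, m)` of `m`-dimensional linear subspaces of `ℝⁿ`. -/
structure Gr (n m : ℕ) where
  /-- The underlying linear subspace. -/
  plane : Submodule ℝ (E n)
  finrank_eq : Module.finrank ℝ plane = m

/-- The usual topology of `Gr(n, m)`: the one of the metric `d(V, W) = ‖π_V - π_W‖`, where `π_V` is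
the orthogonal projection onto `V`, regarded as an operator on `ℝⁿ`. -/
instance (n m : ℕ) : TopologicalSpace (Gr n m) :=
  TopologicalSpace.induced (fun V : Gr n m => V.plane.starProjection) inferInstance

instance (n m : ℕ) : MeasurableSpace (Gr n m) := borel _

instance (n m : ℕ) : BorelSpace (Gr n m) := ⟨rfl⟩

/-- The orthogonal group `O(n)`, as a topological group of operators on `ℝⁿ`. -/
abbrev O (n : ℕ) : Type := unitary (E n →L[ℝ] E n)

instance (n : ℕ) : ContinuousStar (E n →L[ℝ] E n) :=
  ⟨(ContinuousLinearMap.adjoint (𝕜 := ℝ) (E := E n) (F := E n)).continuous⟩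

instance (n : ℕ) : CompactSpace (O n) := by
  refine isCompact_iff_compactSpace.mp (Metric.isCompact_of_isClosed_isBounded isClosed_unitary ?_)
  refine (Metric.isBounded_closedBall (x := (0 : E n →L[ℝ] E n)) (r := 1)).subset fun u hu => ?_
  rw [mem_closedBall_zero_iff]
  exact ContinuousLinearMap.opNorm_le_bound _ zero_le_one fun x => by
    rw [one_mul]
    exact ((Unitary.linearIsometryEquiv ⟨u, hu⟩).norm_map x).le

/-- The Haar probability measure of `O(n)`. -/
def haarO (n : ℕ) : Measure (O n) := Measure.haarMeasure ⊤

/-- The coordinate plane `ℝᵐ × {0}` in `ℝⁿ`. -/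
def coordPlane (n m : ℕ) (h : m ≤ n) : Gr n m :=
  ⟨Submodule.span ℝ (range fun i : Fin m => EuclideanSpace.basisFun (Fin n) ℝ (Fin.castLE h i)), by
    have h1 : LinearIndependent ℝ (EuclideanSpace.basisFun (Fin n) ℝ) :=
      (EuclideanSpace.basisFun (Fin n) ℝ).orthonormal.linearIndependent
    have h2 := h1.comp (Fin.castLE h) (Fin.castLE_injective h)
    have h3 := finrank_span_eq_card h2
    rw [Fintype.card_fin] at h3
    simpa [Function.comp_def] using h3⟩

/-- The action of `O(n)` on `Gr(n, m)`: the image plane `u(V)`. -/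
def rotate {n m : ℕ} (u : O n) (V : Gr n m) : Gr n m :=
  ⟨V.plane.map (Unitary.linearIsometryEquiv u).toLinearEquiv.toLinearMap, by
    rw [LinearEquiv.finrank_map_eq]; exact V.finrank_eq⟩

/-- The rotation invariant probability measure `γ_{n,m}` on `Gr(n, m)`: the image of the Haar
probability measure of `O(n)` under `u ↦ u(ℝᵐ × {0})`. -/
def grassmannMeasure (n m : ℕ) (h : m ≤ n) : Measure (Gr n m) :=
  (haarO n).map fun u => rotate u (coordPlane n m h)

instance (n : ℕ) : IsProbabilityMeasure (haarO n) :=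
  ⟨by simpa [haarO] using Measure.haarMeasure_self (G := O n) (K₀ := ⊤)⟩

theorem continuous_rotate {n m : ℕ} (V : Gr n m) : Continuous fun u : O n => rotate u V := by
  refine continuous_induced_rng.mpr ?_
  have : ((fun V : Gr n m => V.plane.starProjection) ∘ fun u : O n => rotate u V)
      = fun u : O n => (u : E n →L[ℝ] E n) * V.plane.starProjection * star (u : E n →L[ℝ] E n) := by
    funext u
    ext1 x
    exact Submodule.starProjection_map_apply (Unitary.linearIsometryEquiv u) V.plane x
  rw [this]
  fun_prop

instance (n m : ℕ) (h : m ≤ n) : IsProbabilityMeasure (grassmannMeasure n m h) :=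
  Measure.isProbabilityMeasure_map (continuous_rotate _).measurable.aemeasurable

/-! ### Projections, disintegrations, purely atomic measures -/

/-- The orthogonal projection `π_V : ℝⁿ → V`. -/
def proj {n m : ℕ} (V : Gr n m) : E n → V.plane := fun x => V.plane.orthogonalProjectionOnto x

/-- The push-forward `π_V μ`, a measure on the plane `V`. -/
def projMeasure {n m : ℕ} (V : Gr n m) (μ : Measure (E n)) : Measure V.plane := μ.map (proj V)

/-- `κ = (μ_{V,y})_{y ∈ V}` is a disintegration of `μ` with respect to `π_V`: a Borel family of
probability measures with `μ(B) = ∫ μ_{V,y}(B) d(π_V μ)(y)` for all Borel sets `B`, such that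
`μ_{V,y}` is concentrated on the fibre `π_V⁻¹(y)` for `π_V μ`-a.e. `y`. -/
structure IsDisintegration {n m : ℕ} (V : Gr n m) (μ : Measure (E n)) (κ : Kernel V.plane (E n)) :
    Prop where
  isMarkov : IsMarkovKernel κ
  measure_eq : ∀ B : Set (E n), MeasurableSet B → μ B = ∫⁻ y, κ y B ∂(projMeasure V μ)
  concentrated : ∀ᵐ y ∂(projMeasure V μ), κ y (proj V ⁻¹' {y})ᶜ = 0

/-- A measure on `ℝⁿ` is purely atomic if it is concentrated on a countable set. -/
def PurelyAtomic {n : ℕ} (ν : Measure (E n)) : Prop :=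
  ∃ S : Set (E n), S.Countable ∧ ν Sᶜ = 0

/-- The conditional measures `μ_{V,y}` are purely atomic for `ℋᵐ`-a.e. `y ∈ V`. As the family
`(μ_{V,y})` is determined by `μ` only for `π_V μ`-a.e. `y`, this is asked of some version. -/
def HasAtomicSlices {n m : ℕ} (V : Gr n m) (μ : Measure (E n)) : Prop :=
  ∃ κ : Kernel V.plane (E n), IsDisintegration V μ κ ∧ ∀ᵐ y ∂(μH[m] : Measure V.plane), PurelyAtomic (κ y)

/-! ### Rectifiability -/

/-- A Borel set is countably `m`-rectifiable if it is the union of countably many Lipschitz images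
of bounded subsets of `ℝᵐ`. -/
def CountablyRectifiable {n : ℕ} (m : ℕ) (R : Set (E n)) : Prop :=
  MeasurableSet R ∧ ∃ (A : ℕ → Set (E m)) (f : ℕ → E m → E n),
    (∀ i, Bornology.IsBounded (A i)) ∧ (∀ i, ∃ K, LipschitzOnWith K (f i) (A i)) ∧
      R = ⋃ i, f i '' A i

/-- A finite Borel measure is `m`-rectifiable if it is absolutely continuous with respect to `ℋᵐ`
and concentrated on a countably `m`-rectifiable set. -/
def RectifiableMeasure {n : ℕ} (m : ℕ) (μ : Measure (E n)) : Prop :=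
  IsFiniteMeasure μ ∧ μ ≪ μH[m] ∧ ∃ R : Set (E n), CountablyRectifiable m R ∧ μ Rᶜ = 0

end BesicovitchFederer

end

set_option linter.unusedSectionVars false

/-! The rectifiable part is the trace of `μ` on a rectifiable set of maximal mass, minus an
`ℋᵐ`-null set of maximal mass. Mass in the null set projects singularly, since projections are
Lipschitz. The content is that a set `A` without rectifiable mass projects singularly when the
slices are atomic (`mutuallySingular_projMeasure`).

Suppose it does not. Over the absolutely continuous part of `π_V μ`, almost every `x` is an atom of
its slice, and `π_V μ` has positive density at `π_V x`. So for any measurable `F`, at almost every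
such `x ∈ F`, the slab of width `ρ` around the fibre through `x` contains at least `c ρ^m` of the
mass of `F` (`ae_le_measure_slab`). If cones around the fibre of radius `r` and aperture `s` have
mass at most a small multiple of `(r s)^m`, then a suitable piece of `A` avoids them, because a slab
of the piece would otherwise be covered by two such cones (`le_norm_of_small_cones`). On that piece
`π_V` is bi-Lipschitz, so the piece is rectifiable, a contradiction.

The cones are small for almost every `V` and `μ`-almost every `x` whose slabs have mass `O(ρ^m)`
(`ae_thinConesAt`); atomicity plays no role here. By Fubini `x` is fixed and `V` varies. Varying the
plane by reflections with parameter `τ ∈ V` turns each point into a direction `θ` and a distance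
`d`; slabs are compared with tubes `‖θ - τ‖ d < ρ`, cones with sectors `‖θ - τ‖ < s`, `d < r`. If
`b_j` is the density of directions at distance about `2^{-j}`, the tube bound makes `∑ 2^{jk}
b_j(τ)` converge, so its terms tend to zero and sectors have mass `o((r s)^k)` (`ae_sector_le`).
Invariance of Haar measure carries this from reflections to all planes. -/

namespace BesicovitchFederer

/-! ### Semicontinuity of slice measures -/

/-- Measures of the slices of an open set are lower semicontinuous. -/
theorem isClosed_measure_slice_le {Y X : Type*} [TopologicalSpace Y] [FirstCountableTopology Y]
    [TopologicalSpace X] [MeasurableSpace X] [OpensMeasurableSpace X] (β : Measure X)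
    {O : Set (Y × X)} (hO : IsOpen O) (a : ℝ≥0∞) :
    IsClosed {y | β {z | (y, z) ∈ O} ≤ a} := by
  have hslice : ∀ y, MeasurableSet {z | (y, z) ∈ O} := fun y =>
    (hO.preimage (by fun_prop : Continuous fun z : X => (y, z))).measurableSet
  -- Fatou's lemma along a sequence: indicators of open slices are lower semicontinuous in `y`.
  refine IsSeqClosed.isClosed fun u y hu huy => ?_
  have h1 : β {z | (y, z) ∈ O} = ∫⁻ z, {z | (y, z) ∈ O}.indicator 1 z ∂β :=
    (lintegral_indicator_one (hslice y)).symm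
  have h2 : ∀ z, {z | (y, z) ∈ O}.indicator (1 : X → ℝ≥0∞) z
      ≤ liminf (fun k => {z | (u k, z) ∈ O}.indicator (1 : X → ℝ≥0∞) z) atTop := by
    intro z
    by_cases hz : (y, z) ∈ O
    · have : ∀ᶠ k in atTop, (u k, z) ∈ O :=
        (huy.prodMk_nhds tendsto_const_nhds).eventually (hO.mem_nhds hz)
      refine le_liminf_of_le (by isBoundedDefault) ?_
      filter_upwards [this] with k hk
      simp [indicator, hz, hk]
    · simp [indicator, hz]
  change β {z | (y, z) ∈ O} ≤ a
  rw [h1]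
  refine (lintegral_mono h2).trans ((lintegral_liminf_le fun k =>
    measurable_one.indicator (hslice (u k))).trans ?_)
  refine liminf_le_of_le (by isBoundedDefault) fun b hb => ?_
  obtain ⟨k, hk⟩ := hb.exists
  exact hk.trans ((lintegral_indicator_one (hslice (u k))).le.trans (hu k))

/-! ### Coverings and density points in finite dimension -/

section FiniteDimensional

variable {T : Type*} [NormedAddCommGroup T] [NormedSpace ℝ T] [FiniteDimensional ℝ T]
  [MeasurableSpace T] [BorelSpace T]

/-- The Besicovitch covering theorem needs no doubling of `α`, and the good radii may depend on the
centre. -/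
theorem measure_le_of_frequently_closedBall_le (α ν : Measure T) [IsLocallyFiniteMeasure α]
    [IsLocallyFiniteMeasure ν] (σ : Set T)
    (h : ∀ t ∈ σ, ∃ᶠ s in 𝓝[>] (0 : ℝ), α (Metric.closedBall t s) ≤ ν (Metric.closedBall t s)) :
    α σ ≤ ν σ :=
  (Besicovitch.vitaliFamily α).measure_le_of_frequently_le ν Measure.AbsolutelyContinuous.rfl σ
    fun t ht => (Besicovitch.tendsto_filterAt α t).frequently (h t ht)

theorem addHaar_closedBall_eq (vol : Measure T) [vol.IsAddHaarMeasure] (t : T) {r : ℝ}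
    (hr : 0 ≤ r) : vol (Metric.closedBall t r)
      = ENNReal.ofReal (r ^ Module.finrank ℝ T) * vol (Metric.ball 0 1) :=
  Measure.addHaar_closedBall vol t hr

/-- If a measure is dominated by a multiple of Lebesgue measure on the small balls centred in a
closed set `K`, then off `K` it is dominated by Lebesgue measure off `K`. -/
theorem measure_ball_diff_le (vol : Measure T) [vol.IsAddHaarMeasure] (α : Measure T) {K : Set T}
    (hK : IsClosed K) (c : ℝ≥0∞) {R : ℝ}
    (h : ∀ t ∈ K, ∀ s, 0 < s → s < R → α (Metric.closedBall t s) ≤ c * vol (Metric.closedBall t s))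
    {t : T} (ht : t ∈ K) {s : ℝ} (hs : 7 / 2 * s < R) :
    α (Metric.ball t s \ K) ≤ c * ENNReal.ofReal (7 ^ Module.finrank ℝ T)
      * vol (Metric.closedBall t (2 * s) \ K) := by
  set D : T → ℝ := fun y => Metric.infDist y K with hD
  have hne : K.Nonempty := ⟨t, ht⟩
  set U := Metric.ball t s \ K with hU
  have hDpos : ∀ y ∈ U, 0 < D y := fun y hy =>
    (hK.notMem_iff_infDist_pos hne).1 hy.2
  have hDlt : ∀ y ∈ U, D y < s := fun y hy =>
    (Metric.infDist_le_dist_of_mem ht).trans_lt hy.1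
  -- A Whitney-type family: balls whose radius is half the distance to `K`, hence disjoint from `K`.
  obtain ⟨u, huU, hdisj, hcov⟩ := Vitali.exists_disjoint_subfamily_covering_enlargement_closedBall
    U (fun y => y) (fun y => D y / 2) (s / 2) (fun y hy => by have := hDlt y hy; linarith) 5
    (by norm_num)
  have hucount : u.Countable := by
    refine hdisj.countable_of_nonempty_interior fun y hy => ?_
    refine ⟨y, mem_interior_iff_mem_nhds.2 (Metric.closedBall_mem_nhds y ?_)⟩
    have := hDpos y (huU hy); linarith
  have hsub : ∀ y ∈ u, Metric.closedBall y (D y / 2) ⊆ Metric.closedBall t (2 * s) \ K := by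
    intro y hy z hz
    have h1 := hDpos y (huU hy)
    have h2 := hDlt y (huU hy)
    have h3 : dist y t < s := (huU hy).1
    rw [Metric.mem_closedBall] at hz
    refine ⟨?_, fun hzK => ?_⟩
    · rw [Metric.mem_closedBall]
      linarith [dist_triangle z y t]
    · have : D y ≤ dist y z := Metric.infDist_le_dist_of_mem hzK
      rw [dist_comm] at this
      linarith
  have hball : ∀ y ∈ u, α (Metric.closedBall y (5 * (D y / 2)))
      ≤ c * ENNReal.ofReal (7 ^ Module.finrank ℝ T) * vol (Metric.closedBall y (D y / 2)) := by
    intro y hy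
    have h1 := hDpos y (huU hy)
    have h2 := hDlt y (huU hy)
    -- Moving the centre to a nearest point of `K` costs `D y`, so radius `5 D/2` becomes `7 D/2`.
    -- This is the source of the factor `7 ^ k` and of the condition on `R`.
    obtain ⟨κ, hκ, hκd⟩ := hK.exists_infDist_eq_dist hne y
    have hκd : D y = dist y κ := hκd
    calc α (Metric.closedBall y (5 * (D y / 2)))
        ≤ α (Metric.closedBall κ (7 * (D y / 2))) := by
          refine measure_mono (Metric.closedBall_subset_closedBall' ?_)
          linarith
      _ ≤ c * vol (Metric.closedBall κ (7 * (D y / 2))) := h κ hκ _ (by linarith) (by linarith)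
      _ = _ := by
          rw [addHaar_closedBall_eq vol _ (by linarith), addHaar_closedBall_eq vol _ (by linarith),
            mul_pow, ENNReal.ofReal_mul (by positivity)]
          ring
  calc α U ≤ α (⋃ y ∈ u, Metric.closedBall y (5 * (D y / 2))) := by
        refine measure_mono fun z hz => ?_
        obtain ⟨b, hb, hzb⟩ := hcov z hz
        refine mem_iUnion₂.2 ⟨b, hb, hzb (Metric.mem_closedBall_self ?_)⟩
        have := hDpos z hz; linarith
    _ ≤ ∑' y : u, α (Metric.closedBall (y : T) (5 * (D y / 2))) :=
        measure_biUnion_le α hucount _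
    _ ≤ ∑' y : u, c * ENNReal.ofReal (7 ^ Module.finrank ℝ T)
          * vol (Metric.closedBall (y : T) (D y / 2)) :=
        ENNReal.tsum_le_tsum fun y => hball y y.2
    _ = c * ENNReal.ofReal (7 ^ Module.finrank ℝ T)
          * vol (⋃ y ∈ u, Metric.closedBall y (D y / 2)) := by
        rw [ENNReal.tsum_mul_left, measure_biUnion hucount hdisj
          fun y _ => Metric.isClosed_closedBall.measurableSet]
    _ ≤ _ := by
        gcongr
        exact iUnion₂_subset hsub

/-- By inner regularity, compact subsets exhaust `F` up to a null set. This allows passing to closed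
sets and their density points. -/
theorem ae_of_forall_isCompact (vol : Measure T) [vol.IsAddHaarMeasure] {F : Set T}
    (hF : MeasurableSet F) {P : T → Prop}
    (h : ∀ K ⊆ F, IsCompact K → ∀ᵐ t ∂vol, t ∈ K → P t) : ∀ᵐ t ∂vol, t ∈ F → P t := by
  have hex : ∀ n i : ℕ, ∃ K ⊆ F ∩ Metric.closedBall 0 n, IsCompact K ∧
      vol ((F ∩ Metric.closedBall 0 n) \ K) < ((i : ℝ≥0∞) + 1)⁻¹ := fun n i =>
    (hF.inter Metric.isClosed_closedBall.measurableSet).exists_isCompact_sdiff_lt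
      ((measure_mono inter_subset_right).trans_lt measure_closedBall_lt_top).ne (by simp)
  choose K hKs hKc hKv using hex
  have h1 : ∀ᵐ t ∂vol, ∀ n i, t ∈ K n i → P t := by
    simp only [ae_all_iff]
    exact fun n i => h _ ((hKs n i).trans inter_subset_left) (hKc n i)
  have h2 : ∀ᵐ t ∂vol, ∀ n : ℕ, t ∉ (F ∩ Metric.closedBall 0 n) \ ⋃ i, K n i := by
    rw [ae_all_iff]
    intro n
    rw [← measure_eq_zero_iff_ae_notMem]
    refine le_antisymm (ge_of_tendsto' (ENNReal.tendsto_inv_nat_nhds_zero.comp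
      (tendsto_add_atTop_nat 1)) fun i => ?_) bot_le
    refine (measure_mono (sdiff_subset_sdiff_right (subset_iUnion (K n) i))).trans
      ((hKv n i).le.trans ?_)
    simp
  filter_upwards [h1, h2] with t ht1 ht2 htF
  obtain ⟨n, hn⟩ := exists_nat_ge ‖t‖
  by_contra hP
  refine ht2 n ⟨⟨htF, by simpa using hn⟩, fun hU => ?_⟩
  obtain ⟨i, hi⟩ := mem_iUnion.1 hU
  exact hP (ht1 n i hi)

/-! ### Tubes and sectors in direction–distance coordinates -/

/-- The set of pairs `(τ, d)` whose direction `τ` deviates from `t` by less than `ρ` at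
distance `d`. -/
def tube (t : T) (ρ : ℝ) : Set (T × ℝ) := {p | 0 < p.2 ∧ ‖p.1 - t‖ * p.2 < ρ}

/-- The pairs `(τ, d)` with `d < r` and direction `τ` within `s` of `t`. -/
def sector (t : T) (s r : ℝ) : Set (T × ℝ) := {p | 0 < p.2 ∧ p.2 < r ∧ ‖p.1 - t‖ < s}

/-- The pairs `(τ, d)` with `d` in the `j`-th dyadic interval. -/
def annulus (T : Type*) (j : ℕ) : Set (T × ℝ) := {p | (1 / 2) ^ (j + 1) < p.2 ∧ p.2 ≤ (1 / 2) ^ j}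

/-- The distribution of directions in the `j`-th dyadic annulus. -/
noncomputable def layer (β : Measure (T × ℝ)) (j : ℕ) : Measure T := (β.restrict (annulus T j)).map Prod.fst

instance (β : Measure (T × ℝ)) [IsFiniteMeasure β] (j : ℕ) : IsFiniteMeasure (layer β j) := by
  unfold layer; infer_instance

theorem layer_apply (β : Measure (T × ℝ)) (j : ℕ) {σ : Set T} (hσ : MeasurableSet σ) :
    layer β j σ = β (Prod.fst ⁻¹' σ ∩ annulus T j) := by
  rw [layer, Measure.map_apply measurable_fst hσ, Measure.restrict_apply (measurable_fst hσ)]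

theorem measurableSet_annulus (j : ℕ) : MeasurableSet (annulus T j) :=
  (measurableSet_lt measurable_const measurable_snd).inter
    (measurableSet_le measurable_snd measurable_const)

theorem pairwise_disjoint_annulus : Pairwise (Function.onFun Disjoint (annulus T)) := by
  have key : ∀ i j : ℕ, i < j → Disjoint (annulus T i) (annulus T j) := by
    intro i j hij
    refine Set.disjoint_left.2 fun p hp hq => ?_
    have h1 : ((1 : ℝ) / 2) ^ j ≤ (1 / 2) ^ (i + 1) :=
      pow_le_pow_of_le_one (by norm_num) (by norm_num) hij
    exact absurd (hp.1.trans_le (hq.2.trans h1)) (lt_irrefl _)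
  intro i j hij
  rcases lt_or_gt_of_ne hij with h | h
  · exact key i j h
  · exact (key j i h).symm

/-- The densities of the dyadic layers are summable at the points where the mass of the tubes
is of the order of their width. -/
theorem tsum_density_ne_top (vol : Measure T) [vol.IsAddHaarMeasure] (β : Measure (T × ℝ))
    (N : ℕ) (t : T) (b : ℕ → ℝ≥0∞)
    (ht : ∀ ρ : ℝ, 0 < ρ → ρ < 1 / (N + 1) →
      β (tube t ρ) ≤ ENNReal.ofReal (N * ρ ^ Module.finrank ℝ T))
    (hb : ∀ j, Tendsto (fun s => layer β j (Metric.closedBall t s) / vol (Metric.closedBall t s))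
      (𝓝[>] 0) (𝓝 (b j))) :
    ∑' j, ENNReal.ofReal (2 ^ (j * Module.finrank ℝ T)) * b j ≠ ∞ := by
  set k := Module.finrank ℝ T with hk
  set ω := vol (Metric.ball (0 : T) 1) with hω
  have hω0 : ω ≠ 0 := (Metric.measure_ball_pos vol _ one_pos).ne'
  have hωt : ω ≠ ∞ := measure_ball_lt_top.ne
  have hbound : ∑' j, ENNReal.ofReal (2 ^ (j * k)) * b j ≤ ENNReal.ofReal (N * 2 ^ k) / ω := by
    refine ENNReal.tsum_le_of_sum_range_le fun L => ?_
    have hscale : ∀ j : ℕ, Tendsto (fun ρ : ℝ => 2 ^ j * ρ) (𝓝[>] 0) (𝓝[>] 0) := by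
      intro j
      refine tendsto_nhdsWithin_iff.2 ⟨?_, ?_⟩
      · have : Tendsto (fun ρ : ℝ => 2 ^ j * ρ) (𝓝 0) (𝓝 (2 ^ j * 0)) :=
          tendsto_const_nhds.mul tendsto_id
        rw [mul_zero] at this
        exact this.mono_left nhdsWithin_le_nhds
      · filter_upwards [self_mem_nhdsWithin] with ρ hρ
        have : (0 : ℝ) < ρ := hρ
        exact mem_Ioi.2 (by positivity)
    -- Layer `j` is sampled at radius `2^j ρ`: the weight `2^{jk}` cancels against the volume, and
    -- since `d ≤ 2^{-j}` there, all the pieces fit in one tube. Width `2 ρ` rather than `ρ` makes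
    -- the inequality strict.
    have hlim : Tendsto (fun ρ : ℝ => ∑ j ∈ Finset.range L, ENNReal.ofReal (2 ^ (j * k)) *
        (layer β j (Metric.closedBall t (2 ^ j * ρ)) / vol (Metric.closedBall t (2 ^ j * ρ))))
        (𝓝[>] 0) (𝓝 (∑ j ∈ Finset.range L, ENNReal.ofReal (2 ^ (j * k)) * b j)) := by
      refine tendsto_finsetSum _ fun j _ => ?_
      exact ENNReal.Tendsto.const_mul ((hb j).comp (hscale j)) (Or.inr ENNReal.ofReal_ne_top)
    refine le_of_tendsto hlim ?_
    have hN : (0 : ℝ) < 1 / (N + 1) / 2 := by positivity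
    filter_upwards [Ioo_mem_nhdsGT hN] with ρ hρ
    have hρ0 : 0 < ρ := hρ.1
    have hden : ENNReal.ofReal (ρ ^ k) * ω ≠ 0 :=
      mul_ne_zero (by simpa using pow_pos hρ0 k) hω0
    calc _ = ∑ j ∈ Finset.range L, layer β j (Metric.closedBall t (2 ^ j * ρ))
            / (ENNReal.ofReal (ρ ^ k) * ω) := by
          refine Finset.sum_congr rfl fun j _ => ?_
          rw [addHaar_closedBall_eq vol t (by positivity), mul_pow, ← pow_mul,
            ENNReal.ofReal_mul (by positivity), mul_assoc, ← mul_div_assoc,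
            ENNReal.mul_div_mul_left _ _ (by simp) ENNReal.ofReal_ne_top]
      _ = (∑ j ∈ Finset.range L, β (Prod.fst ⁻¹' (Metric.closedBall t (2 ^ j * ρ)) ∩ annulus T j))
            / (ENNReal.ofReal (ρ ^ k) * ω) := by
          simp_rw [div_eq_mul_inv]
          rw [Finset.sum_mul]
          simp_rw [layer_apply β _ Metric.isClosed_closedBall.measurableSet]
      _ = β (⋃ j ∈ Finset.range L, Prod.fst ⁻¹' (Metric.closedBall t (2 ^ j * ρ)) ∩ annulus T j)
            / (ENNReal.ofReal (ρ ^ k) * ω) := by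
          rw [measure_biUnion_finset]
          · exact fun i _ j _ hij => (pairwise_disjoint_annulus hij).mono inter_subset_right
              inter_subset_right
          · exact fun j _ => (measurable_fst Metric.isClosed_closedBall.measurableSet).inter
              (measurableSet_annulus j)
      _ ≤ β (tube t (2 * ρ)) / (ENNReal.ofReal (ρ ^ k) * ω) := by
          gcongr
          refine iUnion₂_subset fun j _ p hp => ?_
          obtain ⟨h1, h2, h3⟩ := hp
          have hp0 : 0 < p.2 := lt_trans (by positivity) h2
          refine ⟨hp0, ?_⟩
          have h4 : ‖p.1 - t‖ ≤ 2 ^ j * ρ := by simpa [dist_eq_norm] using h1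
          calc ‖p.1 - t‖ * p.2 ≤ (2 ^ j * ρ) * (1 / 2) ^ j := by gcongr
            _ = ρ := by rw [mul_right_comm, ← mul_pow]; norm_num
            _ < 2 * ρ := by linarith
      _ ≤ ENNReal.ofReal (N * (2 * ρ) ^ k) / (ENNReal.ofReal (ρ ^ k) * ω) := by
          gcongr
          exact ht _ (by linarith) (by have := hρ.2; linarith)
      _ = ENNReal.ofReal (N * 2 ^ k) / ω := by
          rw [mul_pow, ← mul_assoc, mul_comm _ (ρ ^ k), ENNReal.ofReal_mul (by positivity),
            ENNReal.mul_div_mul_left _ _ (by simpa using pow_pos hρ0 k) ENNReal.ofReal_ne_top]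
  exact (hbound.trans_lt (ENNReal.div_lt_top ENNReal.ofReal_ne_top hω0)).ne

/-- The radii allowed by `h` are not uniform in the centre, so the bound at scale `s` comes from the
Besicovitch comparison with `c • vol`. -/
theorem layer_inter_ball_le (vol : Measure T) [vol.IsAddHaarMeasure] (β : Measure (T × ℝ))
    [IsFiniteMeasure β] (j : ℕ) {K : Set T} {c : ℝ}
    (h : ∀ t ∈ K, ∀ᶠ s in 𝓝[>] (0 : ℝ), layer β j (Metric.closedBall t s)
      ≤ ENNReal.ofReal c * vol (Metric.closedBall t s)) (t : T) {s : ℝ} (hs : 0 < s) :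
    layer β j (K ∩ Metric.ball t s)
      ≤ ENNReal.ofReal (c * s ^ Module.finrank ℝ T) * vol (Metric.ball 0 1) := by
  calc layer β j (K ∩ Metric.ball t s) ≤ ((c.toNNReal) • vol) (K ∩ Metric.ball t s) :=
        measure_le_of_frequently_closedBall_le _ _ _ fun x hx =>
          ((h x hx.1).mono fun r hr => hr).frequently
    _ ≤ ENNReal.ofReal c * vol (Metric.closedBall t s) := by
        rw [Measure.smul_apply]
        exact mul_le_mul_right (measure_mono (inter_subset_right.trans
          Metric.ball_subset_closedBall)) _
    _ = _ := by
        rw [addHaar_closedBall_eq vol t hs.le, ENNReal.ofReal_mul' (by positivity), mul_assoc]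

/-- The part of a thin sector pointing into `K`. -/
theorem sector_inter_le (vol : Measure T) [vol.IsAddHaarMeasure] (hk : 0 < Module.finrank ℝ T)
    (β : Measure (T × ℝ)) [IsFiniteMeasure β] {K : Set T} (hK : MeasurableSet K) {J : ℕ} {ε : ℝ}
    (hε : 0 < ε)
    (h : ∀ t ∈ K, ∀ j ≥ J, ∀ᶠ s in 𝓝[>] (0 : ℝ), layer β j (Metric.closedBall t s)
      ≤ ENNReal.ofReal (ε * (1 / 2) ^ (j * Module.finrank ℝ T)) * vol (Metric.closedBall t s))
    (t : T) {s r : ℝ} (hs : 0 < s) (hr : 0 < r) (hrJ : r < (1 / 2) ^ J) :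
    β (sector t s r ∩ Prod.fst ⁻¹' K) ≤ ENNReal.ofReal (2 * 2 ^ Module.finrank ℝ T * ε
      * (r * s) ^ Module.finrank ℝ T) * vol (Metric.ball 0 1) := by
  set k := Module.finrank ℝ T with hkdef
  -- The dyadic scale of `r`: only layers `j ≥ j₀` meet the sector, and `2^{-j₀} ≤ 2 r`.
  obtain ⟨j₀, hj₀, hj₀'⟩ := exists_nat_pow_near_of_lt_one hr
    (hrJ.le.trans (pow_le_one₀ (by norm_num) (by norm_num))) (by norm_num : (0 : ℝ) < 1 / 2)
    (by norm_num)
  have hJ : J ≤ j₀ := by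
    have := (pow_lt_pow_iff_right_of_lt_one₀ (by norm_num : (0 : ℝ) < 1 / 2) (by norm_num)).1
      (hj₀.trans hrJ)
    omega
  have hsum : Summable fun i : ℕ => ((1 : ℝ) / 2) ^ i := summable_geometric_two
  calc β (sector t s r ∩ Prod.fst ⁻¹' K)
      ≤ β (⋃ i : ℕ, Prod.fst ⁻¹' (K ∩ Metric.ball t s) ∩ annulus T (j₀ + i)) := by
        refine measure_mono fun p hp => ?_
        obtain ⟨⟨h0, hpr, hps⟩, hpK⟩ := hp
        obtain ⟨j, hj, hj'⟩ := exists_nat_pow_near_of_lt_one h0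
          (hpr.le.trans (hrJ.le.trans (pow_le_one₀ (by norm_num) (by norm_num))))
          (by norm_num : (0 : ℝ) < 1 / 2) (by norm_num)
        have hjj : j₀ ≤ j := by
          have := (pow_lt_pow_iff_right_of_lt_one₀ (by norm_num : (0 : ℝ) < 1 / 2)
            (by norm_num)).1 (hj.trans (hpr.trans_le hj₀'))
          omega
        refine mem_iUnion.2 ⟨j - j₀, ⟨hpK, by simpa [dist_eq_norm] using hps⟩, ?_⟩
        rw [Nat.add_sub_cancel' hjj]
        exact ⟨hj, hj'⟩
    _ ≤ ∑' i : ℕ, layer β (j₀ + i) (K ∩ Metric.ball t s) := by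
        refine (measure_iUnion_le _).trans (ENNReal.tsum_le_tsum fun i => ?_)
        rw [layer_apply _ _ (hK.inter Metric.isOpen_ball.measurableSet)]
    _ ≤ ∑' i : ℕ, ENNReal.ofReal (ε * (r * 2 * s) ^ k) * vol (Metric.ball 0 1)
          * ENNReal.ofReal ((1 / 2) ^ i) := by
        refine ENNReal.tsum_le_tsum fun i => ?_
        refine (layer_inter_ball_le vol β (j₀ + i) (fun t ht => h t ht _ (by omega)) t hs).trans ?_
        rw [mul_right_comm (ENNReal.ofReal (ε * (r * 2 * s) ^ k)),
          ← ENNReal.ofReal_mul (by positivity)]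
        gcongr ?_ * _
        refine ENNReal.ofReal_le_ofReal ?_
        have h1 : ((1 : ℝ) / 2) ^ j₀ ≤ r * 2 := by
          rw [pow_succ] at hj₀; linarith
        -- Positive dimension is needed here: it makes the series over the layers geometric.
        have h2 : ((1 : ℝ) / 2) ^ (i * k) ≤ (1 / 2) ^ i :=
          pow_le_pow_of_le_one (by norm_num) (by norm_num) (Nat.le_mul_of_pos_right i hk)
        calc ε * (1 / 2) ^ ((j₀ + i) * k) * s ^ k
            = ε * (((1 / 2) ^ j₀ * s) ^ k) * (1 / 2) ^ (i * k) := by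
              rw [add_mul, pow_add, pow_mul, mul_pow]; ring
          _ ≤ ε * (r * 2 * s) ^ k * (1 / 2) ^ i := by gcongr
    _ = ENNReal.ofReal (ε * (r * 2 * s) ^ k) * vol (Metric.ball 0 1) * ENNReal.ofReal 2 := by
        rw [ENNReal.tsum_mul_left, ← ENNReal.ofReal_tsum_of_nonneg (fun i => by positivity) hsum,
          tsum_geometric_two]
    _ = _ := by
        rw [mul_right_comm, ← ENNReal.ofReal_mul (by positivity)]
        congr 2
        rw [mul_right_comm r 2 s, mul_pow _ (2 : ℝ)]
        ring

/-- The part of a thin sector pointing out of `K`, at a density point of `K`. -/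
theorem sector_diff_le (vol : Measure T) [vol.IsAddHaarMeasure]
    (β : Measure (T × ℝ)) {K : Set T} (hK : IsClosed K) {N : ℕ} {ε : ℝ} (hε : 0 < ε)
    (h : ∀ t ∈ K, ∀ ρ : ℝ, 0 < ρ → ρ < 1 / (N + 1) →
      β (tube t ρ) ≤ ENNReal.ofReal (N * ρ ^ Module.finrank ℝ T)) {t : T} (ht : t ∈ K)
    (hd : Tendsto (fun r => vol (Kᶜ ∩ Metric.closedBall t r) / vol (Metric.closedBall t r))
      (𝓝[>] 0) (𝓝 0)) :
    ∀ᶠ s in 𝓝[>] (0 : ℝ), ∀ r : ℝ, 0 < r → r ≤ 1 → β (sector t s r ∩ Prod.fst ⁻¹' Kᶜ)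
      ≤ ENNReal.ofReal (ε * (r * s) ^ Module.finrank ℝ T) := by
  set k := Module.finrank ℝ T with hkdef
  set ω := vol (Metric.ball (0 : T) 1) with hω
  have hω0 : ω ≠ 0 := (Metric.measure_ball_pos vol _ one_pos).ne'
  have hωt : ω ≠ ∞ := measure_ball_lt_top.ne
  -- `14 = 7 * 2`: the covering constant times the doubling of the radius. The `+ 1` keeps the
  -- denominator positive.
  set η : ℝ := ε / (N * 14 ^ k + 1) with hη
  have hη0 : 0 < η := by positivity
  have hηN : N * 14 ^ k * η ≤ ε := by
    rw [hη, mul_div_assoc', div_le_iff₀ (by positivity)]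
    nlinarith
  have hN : (0 : ℝ) < 2 / 7 * (1 / (N + 1)) := by positivity
  have hscale : Tendsto (fun s : ℝ => 2 * s) (𝓝[>] 0) (𝓝[>] 0) := by
    refine tendsto_nhdsWithin_iff.2 ⟨?_, ?_⟩
    · have : Tendsto (fun s : ℝ => 2 * s) (𝓝 0) (𝓝 (2 * 0)) :=
        tendsto_const_nhds.mul tendsto_id
      rw [mul_zero] at this
      exact this.mono_left nhdsWithin_le_nhds
    · filter_upwards [self_mem_nhdsWithin] with s hs
      have : (0 : ℝ) < s := hs
      exact mem_Ioi.2 (by positivity)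
  have hsmall := (hd.comp hscale).eventually (gt_mem_nhds (ENNReal.ofReal_pos.2 hη0))
  filter_upwards [hsmall, Ioo_mem_nhdsGT hN] with s hs1 hs2 r hr hr1
  have hs0 : 0 < s := hs2.1
  have hvol : vol (Metric.closedBall t (2 * s) \ K)
      ≤ ENNReal.ofReal η * vol (Metric.closedBall t (2 * s)) := by
    have hpos : vol (Metric.closedBall t (2 * s)) ≠ 0 :=
      (Metric.measure_closedBall_pos vol t (by positivity)).ne'
    have := (ENNReal.div_le_iff hpos measure_closedBall_lt_top.ne).1 hs1.le
    rwa [sdiff_eq, inter_comm]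
  set α : Measure T := (β.restrict {p | 0 < p.2 ∧ p.2 < r}).map Prod.fst with hα
  have hmeas : MeasurableSet {p : T × ℝ | 0 < p.2 ∧ p.2 < r} :=
    (measurableSet_lt measurable_const measurable_snd).inter
      (measurableSet_lt measurable_snd measurable_const)
  have hαapp : ∀ σ : Set T, MeasurableSet σ →
      α σ = β (Prod.fst ⁻¹' σ ∩ {p | 0 < p.2 ∧ p.2 < r}) := fun σ hσ => by
    rw [hα, Measure.map_apply measurable_fst hσ, Measure.restrict_apply (measurable_fst hσ)]
  -- A cylinder of radius `u` and height `r` lies in the tube of width `u r`.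
  have hαball : ∀ x ∈ K, ∀ u : ℝ, 0 < u → u < 1 / (N + 1) → α (Metric.closedBall x u)
      ≤ ENNReal.ofReal (N * r ^ k) / ω * vol (Metric.closedBall x u) := by
    intro x hx u hu huN
    rw [hαapp _ Metric.isClosed_closedBall.measurableSet, addHaar_closedBall_eq vol x hu.le]
    calc _ ≤ β (tube x (u * r)) := by
          refine measure_mono fun p hp => ⟨hp.2.1, ?_⟩
          have h4 : ‖p.1 - x‖ ≤ u := by simpa [dist_eq_norm] using hp.1
          calc ‖p.1 - x‖ * p.2 ≤ u * p.2 := by gcongr; exact hp.2.1.le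
            _ < u * r := by gcongr; exact hp.2.2
      _ ≤ ENNReal.ofReal (N * (u * r) ^ k) := h x hx _ (by positivity)
          ((mul_le_of_le_one_right hu.le hr1).trans_lt huN)
      _ = ENNReal.ofReal (N * r ^ k) * ENNReal.ofReal (u ^ k) := by
          rw [← ENNReal.ofReal_mul (by positivity)]; congr 1; rw [mul_pow]; ring
      _ = _ := by
          rw [mul_comm (ENNReal.ofReal (u ^ k)) ω, ← mul_assoc, ENNReal.div_mul_cancel hω0 hωt]
  calc β (sector t s r ∩ Prod.fst ⁻¹' Kᶜ) ≤ α (Metric.ball t s \ K) := by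
        rw [hαapp _ (Metric.isOpen_ball.measurableSet.diff hK.measurableSet)]
        refine measure_mono fun p hp => ?_
        exact ⟨⟨by simpa [dist_eq_norm] using hp.1.2.2, hp.2⟩, hp.1.1, hp.1.2.1⟩
    _ ≤ ENNReal.ofReal (N * r ^ k) / ω * ENNReal.ofReal (7 ^ k)
          * vol (Metric.closedBall t (2 * s) \ K) :=
        measure_ball_diff_le vol α hK _ hαball ht (by have := hs2.2; linarith)
    _ ≤ ENNReal.ofReal (N * r ^ k) / ω * ENNReal.ofReal (7 ^ k)
          * (ENNReal.ofReal η * (ENNReal.ofReal ((2 * s) ^ k) * ω)) := by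
        rw [← addHaar_closedBall_eq vol t (by positivity)]
        gcongr
    _ = (ω⁻¹ * ω) * (ENNReal.ofReal (N * r ^ k) * ENNReal.ofReal (7 ^ k)
          * (ENNReal.ofReal η * ENNReal.ofReal ((2 * s) ^ k))) := by
        rw [div_eq_mul_inv]; ring
    _ = ENNReal.ofReal (N * 14 ^ k * η * (r * s) ^ k) := by
        rw [ENNReal.inv_mul_cancel hω0 hωt, one_mul, ← ENNReal.ofReal_mul (by positivity),
          ← ENNReal.ofReal_mul (by positivity), ← ENNReal.ofReal_mul (by positivity)]
        congr 1
        rw [show (14 : ℝ) = 7 * 2 by norm_num]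
        simp only [mul_pow]
        ring
    _ ≤ _ := by gcongr

/-- Tubes are open jointly in centre and point, so semicontinuity of slice measures applies to each
`ρ`. -/
theorem isClosed_tube_le (β : Measure (T × ℝ)) (N : ℕ) :
    IsClosed {t : T | ∀ ρ : ℝ, 0 < ρ → ρ < 1 / (N + 1) →
      β (tube t ρ) ≤ ENNReal.ofReal (N * ρ ^ Module.finrank ℝ T)} := by
  simp only [ofPred_forall]
  refine isClosed_iInter fun ρ => isClosed_iInter fun _ => isClosed_iInter fun _ => ?_
  refine isClosed_measure_slice_le β (O := {q : T × (T × ℝ) | 0 < q.2.2 ∧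
    ‖q.2.1 - q.1‖ * q.2.2 < ρ}) ?_ _
  have h1 : Continuous fun q : T × (T × ℝ) => q.2.2 := by fun_prop
  have h2 : Continuous fun q : T × (T × ℝ) => ‖q.2.1 - q.1‖ * q.2.2 := by fun_prop
  exact (isOpen_lt continuous_const h1).inter (isOpen_lt h2 continuous_const)

/-- At almost every direction `t` for which the tubes around `t` have mass of the order of their
width, thin sectors have small mass. -/
theorem ae_sector_le (vol : Measure T) [vol.IsAddHaarMeasure] (hk : 0 < Module.finrank ℝ T)
    (β : Measure (T × ℝ)) [IsFiniteMeasure β] :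
    ∀ᵐ t ∂vol, (∃ N : ℕ, ∀ ρ : ℝ, 0 < ρ → ρ < 1 / (N + 1) →
      β (tube t ρ) ≤ ENNReal.ofReal (N * ρ ^ Module.finrank ℝ T)) →
      ∀ ε : ℝ, 0 < ε → ∃ δ : ℝ, 0 < δ ∧ ∃ s₀ : ℝ, 0 < s₀ ∧ ∀ r s : ℝ, 0 < r → r < δ → 0 < s →
        s < s₀ → β (sector t s r) ≤ ENNReal.ofReal (ε * (r * s) ^ Module.finrank ℝ T) := by
  set k := Module.finrank ℝ T with hkdef
  set ω := vol (Metric.ball (0 : T) 1) with hω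
  have hω0 : ω ≠ 0 := (Metric.measure_ball_pos vol _ one_pos).ne'
  have hωt : ω ≠ ∞ := measure_ball_lt_top.ne
  set b : ℕ → T → ℝ≥0∞ := fun j => (layer β j).rnDeriv vol with hb
  have hlim : ∀ᵐ t ∂vol, ∀ j, Tendsto (fun s => layer β j (Metric.closedBall t s)
      / vol (Metric.closedBall t s)) (𝓝[>] 0) (𝓝 (b j t)) :=
    ae_all_iff.2 fun j => Besicovitch.ae_tendsto_rnDeriv _ _
  -- The conull set of differentiation points is shrunk to a measurable one, so that `F` below is
  -- measurable.
  obtain ⟨D, hDsub, hDmeas, hDae⟩ : ∃ D : Set T, (∀ t ∈ D, ∀ j, Tendsto (fun s =>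
      layer β j (Metric.closedBall t s) / vol (Metric.closedBall t s)) (𝓝[>] 0) (𝓝 (b j t))) ∧
      MeasurableSet D ∧ ∀ᵐ t ∂vol, t ∈ D := by
    obtain ⟨D, hD1, hD2, hD3⟩ := exists_measurable_superset_of_null (ae_iff.1 hlim)
    refine ⟨Dᶜ, fun t ht => ?_, hD2.compl, ?_⟩
    · by_contra hcon
      exact ht (hD1 hcon)
    · rw [ae_iff]; simpa using hD3
  set E : ℕ → Set T := fun N => {t : T | ∀ ρ : ℝ, 0 < ρ → ρ < 1 / (N + 1) →
      β (tube t ρ) ≤ ENNReal.ofReal (N * ρ ^ k)} with hE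
  -- On `F N J i` the tube bound and the decay of the densities hold with uniform constants.
  set F : ℕ → ℕ → ℕ → Set T := fun N J i => E N ∩ D ∩
    {t | ∀ j ≥ J, b j t < ENNReal.ofReal (1 / (i + 1) * (1 / 2) ^ (j * k))} with hF
  have hFmeas : ∀ N J i, MeasurableSet (F N J i) := by
    intro N J i
    refine ((isClosed_tube_le β N).measurableSet.inter hDmeas).inter ?_
    simp only [ofPred_forall]
    exact MeasurableSet.iInter fun j => MeasurableSet.iInter fun _ =>
      measurableSet_lt (Measure.measurable_rnDeriv _ _) measurable_const
  set A : ℝ := 2 * 2 ^ k * ω.toReal + 1 with hA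
  have hA0 : 0 < A := by positivity
  have main : ∀ N J i : ℕ, ∀ᵐ t ∂vol, t ∈ F N J i → ∃ δ : ℝ, 0 < δ ∧ ∃ s₀ : ℝ, 0 < s₀ ∧
      ∀ r s : ℝ, 0 < r → r < δ → 0 < s → s < s₀ →
        β (sector t s r) ≤ ENNReal.ofReal (A * (1 / (i + 1)) * (r * s) ^ k) := by
    intro N J i
    -- At a density point of `K`, directions in `K` are handled by the decay of the layers, the
    -- others by the covering estimate.
    refine ae_of_forall_isCompact vol (hFmeas N J i) fun K hKF hK => ?_
    filter_upwards [Besicovitch.ae_tendsto_measure_inter_div_of_measurableSet vol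
      hK.measurableSet.compl] with t ht htK
    rw [indicator_of_notMem (by simpa using htK)] at ht
    have hi : (0 : ℝ) < 1 / (i + 1) := by positivity
    have hout := sector_diff_le vol β hK.isClosed hi (fun t ht => (hKF ht).1.1) htK ht
    obtain ⟨s₀, hs₀, hs₀'⟩ := (mem_nhdsGT_iff_exists_Ioo_subset).1 hout
    refine ⟨(1 / 2) ^ J, by positivity, s₀, hs₀, fun r s hr hrJ hs hss => ?_⟩
    have h1 := sector_inter_le vol hk β hK.measurableSet hi (J := J) (fun x hx j hj => by
      have h2 := (hDsub x (hKF hx).1.2 j).eventually (gt_mem_nhds ((hKF hx).2 j hj))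
      filter_upwards [h2, self_mem_nhdsWithin] with u hu hu0
      exact (ENNReal.div_le_iff (Metric.measure_closedBall_pos vol x hu0).ne'
        measure_closedBall_lt_top.ne).1 hu.le) t hs hr hrJ
    have h2 := hs₀' ⟨hs, hss⟩ r hr (hrJ.le.trans (pow_le_one₀ (by norm_num) (by norm_num)))
    calc β (sector t s r) ≤ β (sector t s r ∩ Prod.fst ⁻¹' K)
          + β (sector t s r ∩ Prod.fst ⁻¹' Kᶜ) := by
          refine (measure_mono fun p hp => ?_).trans (measure_union_le _ _)
          by_cases hpK : p.1 ∈ K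
          · exact Or.inl ⟨hp, hpK⟩
          · exact Or.inr ⟨hp, hpK⟩
      _ ≤ ENNReal.ofReal (2 * 2 ^ k * (1 / (i + 1)) * (r * s) ^ k) * ENNReal.ofReal ω.toReal
          + ENNReal.ofReal (1 / (i + 1) * (r * s) ^ k) := by
          rw [ENNReal.ofReal_toReal hωt]; exact add_le_add h1 h2
      _ = _ := by
          rw [← ENNReal.ofReal_mul (by positivity), ← ENNReal.ofReal_add (by positivity)
            (by positivity), hA]
          congr 1; ring
  have main' : ∀ᵐ t ∂vol, ∀ N J i, t ∈ F N J i → ∃ δ : ℝ, 0 < δ ∧ ∃ s₀ : ℝ, 0 < s₀ ∧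
      ∀ r s : ℝ, 0 < r → r < δ → 0 < s → s < s₀ →
        β (sector t s r) ≤ ENNReal.ofReal (A * (1 / (i + 1)) * (r * s) ^ k) := by
    simp only [ae_all_iff]; exact main
  filter_upwards [main', hDae] with t ht htD ⟨N, hN⟩ ε hε
  obtain ⟨i, hi⟩ := exists_nat_one_div_lt (div_pos hε hA0)
  -- The terms of a convergent series tend to zero: this upgrades `O` for tubes to `o` for sectors.
  have hterm := ENNReal.tendsto_atTop_zero_of_tsum_ne_top
    (tsum_density_ne_top vol β N t (fun j => b j t) hN (hDsub t htD))
  have hi0 : (0 : ℝ) < 1 / (i + 1) := by positivity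
  obtain ⟨J, hJ⟩ := eventually_atTop.1 (hterm.eventually (gt_mem_nhds (ENNReal.ofReal_pos.2 hi0)))
  have htF : t ∈ F N J i := by
    refine ⟨⟨hN, htD⟩, fun j hj => ?_⟩
    have h1 := hJ j hj
    rw [ENNReal.ofReal_mul (by positivity), mul_comm]
    have h3 : ENNReal.ofReal ((1 / 2) ^ (j * k)) * ENNReal.ofReal (2 ^ (j * k)) = 1 := by
      rw [← ENNReal.ofReal_mul (by positivity), ← mul_pow]; norm_num
    calc b j t = ENNReal.ofReal ((1 / 2) ^ (j * k)) * (ENNReal.ofReal (2 ^ (j * k)) * b j t) := by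
          rw [← mul_assoc, h3, one_mul]
      _ < _ := by
          refine ENNReal.mul_lt_mul_right (by simp) ENNReal.ofReal_ne_top h1
  obtain ⟨δ, hδ, s₀, hs₀, h⟩ := ht N J i htF
  refine ⟨δ, hδ, s₀, hs₀, fun r s hr hrδ hs hss => (h r s hr hrδ hs hss).trans ?_⟩
  gcongr
  rw [lt_div_iff₀ hA0] at hi
  linarith

end FiniteDimensional

/-! ### Tube bounds and thin cones as measurable conditions -/

/-- Mass of slabs `S ρ` of width `ρ` is of order `ρ ^ k`. -/
def TubeBound {X : Type*} [MeasurableSpace X] (k : ℕ) (ν : Measure X) (S : ℝ → Set X) : Prop :=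
  ∃ N : ℕ, ∀ ρ : ℝ, 0 < ρ → ρ < 1 / (N + 1) → ν (S ρ) ≤ ENNReal.ofReal (N * ρ ^ k)

/-- Mass of cones `C r s` of radius `r` and aperture `s` is of order `o((r * s) ^ k)`. -/
def ThinCone {X : Type*} [MeasurableSpace X] (k : ℕ) (ν : Measure X) (C : ℝ → ℝ → Set X) : Prop :=
  ∀ i : ℕ, ∃ j : ℕ, ∀ r s : ℝ, 0 < r → r < 1 / (j + 1) → 0 < s → s < 1 / (j + 1) →
    ν (C r s) ≤ ENNReal.ofReal (1 / (i + 1) * (r * s) ^ k)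

theorem measurableSet_tubeBound {X Y : Type*} [TopologicalSpace Y] [FirstCountableTopology Y]
    [MeasurableSpace Y] [OpensMeasurableSpace Y]
    [TopologicalSpace X] [MeasurableSpace X] [OpensMeasurableSpace X] (k : ℕ) (ν : Measure X)
    (S : Y → ℝ → Set X) (hS : ∀ ρ, IsOpen {q : Y × X | q.2 ∈ S q.1 ρ}) :
    MeasurableSet {y | TubeBound k ν (S y)} := by
  simp only [TubeBound, ofPred_exists, ofPred_forall]
  refine MeasurableSet.iUnion fun N => (IsClosed.measurableSet ?_)
  exact isClosed_iInter fun ρ => isClosed_iInter fun _ => isClosed_iInter fun _ =>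
    isClosed_measure_slice_le ν (hS ρ) _

theorem measurableSet_thinCone {X Y : Type*} [TopologicalSpace Y] [FirstCountableTopology Y]
    [MeasurableSpace Y] [OpensMeasurableSpace Y]
    [TopologicalSpace X] [MeasurableSpace X] [OpensMeasurableSpace X] (k : ℕ) (ν : Measure X)
    (C : Y → ℝ → ℝ → Set X) (hC : ∀ r s, IsOpen {q : Y × X | q.2 ∈ C q.1 r s}) :
    MeasurableSet {y | ThinCone k ν (C y)} := by
  simp only [ThinCone, ofPred_exists, ofPred_forall]
  refine MeasurableSet.iInter fun i => MeasurableSet.iUnion fun j => (IsClosed.measurableSet ?_)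
  exact isClosed_iInter fun r => isClosed_iInter fun s => isClosed_iInter fun _ =>
    isClosed_iInter fun _ => isClosed_iInter fun _ => isClosed_iInter fun _ =>
    isClosed_measure_slice_le ν (hC r s) _

/-! ### Householder reflections -/

section Householder

variable {X : Type*} [NormedAddCommGroup X] [InnerProductSpace ℝ X]

/-- The factor `√(1 + ‖τ‖²)`, the length of `τ + e` for a unit vector `e` orthogonal to `τ`. -/
noncomputable def tilt (τ : X) : ℝ := √(1 + ‖τ‖ ^ 2)

theorem tilt_sq (τ : X) : tilt τ ^ 2 = 1 + ‖τ‖ ^ 2 := Real.sq_sqrt (by positivity)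

theorem one_le_tilt (τ : X) : 1 ≤ tilt τ := by
  rw [tilt, Real.one_le_sqrt]; nlinarith [sq_nonneg ‖τ‖]

theorem continuous_tilt : Continuous (tilt : X → ℝ) := by unfold tilt; fun_prop

/-- The normal vector of the reflection `householder e τ`. -/
noncomputable def mirror (e τ : X) : X := τ + (1 + tilt τ) • e

theorem norm_mirror_sq {e τ : X} (he : ‖e‖ = 1) (heτ : inner ℝ τ e = 0) :
    ‖mirror e τ‖ ^ 2 = 2 * (tilt τ * (tilt τ + 1)) := by
  rw [mirror, norm_add_sq_real, inner_smul_right, heτ, norm_smul, he, Real.norm_eq_abs, mul_one,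
    sq_abs]
  nlinarith [tilt_sq τ]

/-- For a unit vector `e` orthogonal to `τ`, the reflection exchanging the lines spanned by `e`
and by `τ + e`. -/
noncomputable def householder (e τ : X) : X →L[ℝ] X :=
  ContinuousLinearMap.id ℝ X
    - (1 / (tilt τ * (tilt τ + 1))) • (innerSL ℝ (mirror e τ)).smulRight (mirror e τ)

theorem householder_apply (e τ z : X) : householder e τ z
    = z - (1 / (tilt τ * (tilt τ + 1)) * inner ℝ (mirror e τ) z) • mirror e τ := by
  simp [householder, smul_smul]

theorem householder_householder {e τ : X} (he : ‖e‖ = 1) (heτ : inner ℝ τ e = 0) (z : X) :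
    householder e τ (householder e τ z) = z := by
  have ha := one_le_tilt τ
  have h1 : tilt τ * (tilt τ + 1) ≠ 0 := by positivity
  simp only [householder_apply, inner_sub_right, inner_smul_right, real_inner_self_eq_norm_sq,
    norm_mirror_sq he heτ]
  rw [sub_sub, ← add_smul]
  convert sub_zero z using 2
  convert zero_smul ℝ _
  field_simp
  ring

theorem inner_householder (e τ y z : X) :
    inner ℝ (householder e τ y) z = inner ℝ y (householder e τ z) := by
  simp only [householder_apply, inner_sub_right, inner_smul_right, inner_sub_left,
    real_inner_smul_left]
  rw [real_inner_comm y (mirror e τ)]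
  ring

theorem continuous_householder (e : X) : Continuous fun τ : X => householder e τ := by
  have h1 : Continuous fun τ : X => mirror e τ := by
    unfold mirror; have := continuous_tilt (X := X); fun_prop
  have h2 : Continuous fun τ : X => 1 / (tilt τ * (tilt τ + 1)) := by
    refine continuous_const.div ?_ fun τ => ?_
    · have := continuous_tilt (X := X); fun_prop
    · have := one_le_tilt τ; positivity
  unfold householder
  refine continuous_const.sub (h2.smul ?_)
  have h3 : Continuous fun τ : X => innerSL ℝ (mirror e τ) := (innerSL ℝ).continuous.comp h1
  exact ((ContinuousLinearMap.smulRightL ℝ X X).continuous₂.comp (h3.prodMk h1))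

variable {V : Submodule ℝ X} [V.HasOrthogonalProjection] {e : X}

/-- With `w = π_V z - ⟨e, z⟩ τ`, the right-hand side is a linear map of `w` which is the identity on
the complement of `τ` and multiplies `τ` by `1 / tilt τ`. Hence the two-sided norm comparison with
constants `1` and `tilt τ` below. -/
theorem starProjection_householder (heV : e ∈ Vᗮ) (τ : V) (z : X) :
    V.starProjection (householder e τ z)
      = (V.starProjection z - (inner ℝ e z : ℝ) • (τ : X))
        - (1 / (tilt (τ : X) * (tilt (τ : X) + 1))
          * inner ℝ (τ : X) (V.starProjection z - (inner ℝ e z : ℝ) • (τ : X))) • (τ : X) := by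
  set a := tilt (τ : X) with ha
  have ha1 : 1 ≤ a := one_le_tilt _
  have hP : inner ℝ (τ : X) (V.starProjection z) = inner ℝ (τ : X) z := by
    rw [← Submodule.inner_starProjection_left_eq_right,
      Submodule.starProjection_eq_self_iff.2 τ.2]
  have hPτ : V.starProjection (τ : X) = τ := Submodule.starProjection_eq_self_iff.2 τ.2
  have hPe : V.starProjection e = 0 := (Submodule.starProjection_apply_eq_zero_iff V).2 heV
  have hPm : V.starProjection (mirror e τ) = τ := by
    rw [mirror, map_add, map_smul, hPe, hPτ, smul_zero, add_zero]
  have hsq : ‖(τ : X)‖ ^ 2 = a ^ 2 - 1 := by rw [tilt_sq]; ring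
  rw [householder_apply, map_sub, map_smul, hPm, inner_sub_right, hP, inner_smul_right,
    real_inner_self_eq_norm_sq, hsq, ← ha, mirror, inner_add_left, real_inner_smul_left, sub_sub,
    ← add_smul, ← ha]
  congr 2
  have : a * (a + 1) ≠ 0 := by positivity
  field_simp
  ring

/-- Bounds `|⟨e, z⟩|` from below when the reflected vector has a large component along `e` and `w`
is small. -/
theorem inner_householder_unit (he : ‖e‖ = 1) (heV : e ∈ Vᗮ) (τ : V) (z : X) :
    inner ℝ e (householder e τ z) = -(tilt (τ : X) * inner ℝ e z
      + inner ℝ (τ : X) (V.starProjection z - (inner ℝ e z : ℝ) • (τ : X)) / tilt (τ : X)) := by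
  set a := tilt (τ : X) with ha
  have ha1 : 1 ≤ a := one_le_tilt _
  have hP : inner ℝ (τ : X) (V.starProjection z) = inner ℝ (τ : X) z := by
    rw [← Submodule.inner_starProjection_left_eq_right,
      Submodule.starProjection_eq_self_iff.2 τ.2]
  have heτ : inner ℝ e (τ : X) = 0 := Submodule.inner_left_of_mem_orthogonal τ.2 heV
  have hsq : ‖(τ : X)‖ ^ 2 = a ^ 2 - 1 := by rw [tilt_sq]; ring
  rw [householder_apply, inner_sub_right, inner_smul_right, inner_sub_right, hP, inner_smul_right,
    real_inner_self_eq_norm_sq, hsq, ← ha, mirror, inner_add_left, inner_add_right,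
    inner_smul_right, real_inner_smul_left, heτ, real_inner_self_eq_norm_sq, he, ← ha]
  have : a * (a + 1) ≠ 0 := by positivity
  field_simp
  ring

theorem norm_starProjection_householder_le (heV : e ∈ Vᗮ) (τ : V) (z : X) :
    ‖V.starProjection (householder e τ z)‖
      ≤ ‖V.starProjection z - (inner ℝ e z : ℝ) • (τ : X)‖ := by
  rw [starProjection_householder heV]
  set w := V.starProjection z - (inner ℝ e z : ℝ) • (τ : X)
  set a := tilt (τ : X) with ha
  have ha1 : 1 ≤ a := one_le_tilt _
  have hsq : ‖(τ : X)‖ ^ 2 = a ^ 2 - 1 := by rw [tilt_sq]; ring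
  refine le_of_sq_le_sq ?_ (norm_nonneg _) 
  rw [norm_sub_sq_real, inner_smul_right, norm_smul, mul_pow, hsq, Real.norm_eq_abs, sq_abs,
    real_inner_comm (τ : X) w]
  set x : ℝ := inner ℝ (τ : X) w
  have : 2 * (1 / (a * (a + 1)) * x * x) - (1 / (a * (a + 1)) * x) ^ 2 * (a ^ 2 - 1)
      = x ^ 2 / a ^ 2 := by
    have : a * (a + 1) ≠ 0 := by positivity
    field_simp
    ring
  have h2 : 0 ≤ x ^ 2 / a ^ 2 := by positivity
  linarith

theorem le_norm_starProjection_householder (heV : e ∈ Vᗮ) (τ : V) (z : X) :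
    ‖V.starProjection z - (inner ℝ e z : ℝ) • (τ : X)‖
      ≤ tilt (τ : X) * ‖V.starProjection (householder e τ z)‖ := by
  rw [starProjection_householder heV]
  set w := V.starProjection z - (inner ℝ e z : ℝ) • (τ : X)
  set a := tilt (τ : X) with ha
  have ha1 : 1 ≤ a := one_le_tilt _
  have ha2 : a * (a + 1) ≠ 0 := by positivity
  have hsq : ‖(τ : X)‖ ^ 2 = a ^ 2 - 1 := by rw [tilt_sq]; ring
  set x : ℝ := inner ℝ (τ : X) w with hx
  set y := w - (1 / (a * (a + 1)) * x) • (τ : X) with hy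
  have h1 : inner ℝ (τ : X) y = x / a := by
    rw [hy, inner_sub_right, inner_smul_right, real_inner_self_eq_norm_sq, hsq, ← hx]
    field_simp
    ring
  have h2 : w = y + (inner ℝ (τ : X) y / (a + 1)) • (τ : X) := by
    rw [h1, hy, sub_add, ← sub_smul]
    rw [show 1 / (a * (a + 1)) * x - x / a / (a + 1) = 0 by field_simp; ring]
    simp
  have h3 : |inner ℝ (τ : X) y| ≤ ‖(τ : X)‖ * ‖y‖ := abs_real_inner_le_norm _ _
  calc ‖w‖ ≤ ‖y‖ + |inner ℝ (τ : X) y / (a + 1)| * ‖(τ : X)‖ := by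
        rw [h2]; refine (norm_add_le _ _).trans ?_; rw [norm_smul, Real.norm_eq_abs]
    _ ≤ ‖y‖ + ‖(τ : X)‖ * ‖y‖ / (a + 1) * ‖(τ : X)‖ := by
        rw [abs_div, abs_of_pos (by positivity : 0 < a + 1)]
        gcongr
    _ = ‖y‖ * (1 + ‖(τ : X)‖ ^ 2 / (a + 1)) := by ring
    _ = a * ‖y‖ := by
        rw [hsq]; field_simp; ring

end Householder

/-! ### From sectors to cones around reflected fibres -/

/-- Reflecting the plane `V` in the directions `τ ∈ V`: almost every `τ` for which the slabs
around the fibre of the reflected projection have mass of the order of their width has thin cones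
of small mass around that fibre, at least in the directions of the reflected vector `e`. -/
theorem ae_thinCone_householder {X : Type*} [NormedAddCommGroup X] [InnerProductSpace ℝ X]
    [FiniteDimensional ℝ X] [MeasurableSpace X] [BorelSpace X] {V : Submodule ℝ X}
    (hV : 0 < Module.finrank ℝ V) {e : X} (he : ‖e‖ = 1) (heV : e ∈ Vᗮ) (ν : Measure X)
    [IsFiniteMeasure ν] {c : ℝ} (hc : 0 < c) :
    ∀ᵐ τ : V, TubeBound (Module.finrank ℝ V) ν
        (fun ρ => {z | ‖V.starProjection (householder e τ z)‖ < ρ}) →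
      ThinCone (Module.finrank ℝ V) ν (fun r s => {z | ‖z‖ < r ∧
        ‖V.starProjection (householder e τ z)‖ < s * ‖z‖ ∧
        c * ‖z‖ < |inner ℝ e (householder e τ z)|}) := by
  set k := Module.finrank ℝ V with hk
  -- The direction is the slope of `z` over `e`: by the norm comparison, the reflected projection of
  -- `z` has size about `|⟨e, z⟩|` times the distance from the slope to `τ`.
  set f : X → V × ℝ := fun z => ((inner ℝ e z : ℝ)⁻¹ • V.orthogonalProjectionOnto z, ‖z‖) with hf
  have hfm : Measurable f := by
    have h1 : Measurable fun z : X => (inner ℝ e z : ℝ)⁻¹ :=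
      (Continuous.measurable (by fun_prop : Continuous fun z : X => inner ℝ e z)).inv
    have h2 : Measurable fun z : X => V.orthogonalProjectionOnto z :=
      Continuous.measurable (by fun_prop)
    exact (h1.smul h2).prodMk measurable_norm
  have hset : MeasurableSet {z : X | (inner ℝ e z : ℝ) ≠ 0} :=
    (isOpen_ne_fun (by fun_prop) continuous_const).measurableSet
  set β := (ν.restrict {z : X | (inner ℝ e z : ℝ) ≠ 0}).map f with hβ
  have hβapp : ∀ A : Set (V × ℝ), MeasurableSet A →
      β A = ν (f ⁻¹' A ∩ {z : X | (inner ℝ e z : ℝ) ≠ 0}) := fun A hA => by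
    rw [hβ, Measure.map_apply hfm hA, Measure.restrict_apply (hfm hA)]
  have hw : ∀ (τ : V) (z : X), (inner ℝ e z : ℝ) ≠ 0 →
      |inner ℝ e z| * ‖(f z).1 - τ‖ = ‖V.starProjection z - (inner ℝ e z : ℝ) • (τ : X)‖ := by
    intro τ z hz
    rw [← Real.norm_eq_abs, ← norm_smul, smul_sub, hf]
    simp only [smul_smul, mul_inv_cancel₀ hz, one_smul]
    rfl
  filter_upwards [ae_sector_le (volume : Measure V) hV β] with τ hτ ⟨N, hN⟩
  set a := tilt (τ : X) with ha
  have ha1 : 1 ≤ a := one_le_tilt _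
  have hthin := hτ ⟨N, fun ρ hρ hρN => by
    have hmeas : MeasurableSet (tube τ ρ) :=
      ((isOpen_lt continuous_const continuous_snd).inter
        (isOpen_lt (by fun_prop : Continuous fun p : V × ℝ => ‖p.1 - τ‖ * p.2)
          continuous_const)).measurableSet
    rw [hβapp _ hmeas]
    refine (measure_mono fun z hz => ?_).trans (hN ρ hρ hρN)
    obtain ⟨⟨h0, h1⟩, hz0⟩ := hz
    refine (norm_starProjection_householder_le heV τ z).trans_lt ?_
    rw [← hw τ z hz0]
    refine lt_of_le_of_lt ?_ h1
    rw [mul_comm]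
    gcongr
    change |inner ℝ e z| ≤ ‖z‖
    simpa [he] using abs_real_inner_le_norm e z⟩
  intro i
  -- In the cone `‖w‖ < a s ‖z‖` and `‖z‖ < (2 a / c) |⟨e, z⟩|`, so the slope is within `D s` of
  -- `τ`.
  set D : ℝ := 2 * a ^ 2 / c with hD
  have hD0 : 0 < D := by positivity
  obtain ⟨δ, hδ, s₀, hs₀, h⟩ := hthin (1 / (i + 1) / D ^ k) (by positivity)
  -- Apertures below `b` let half of `c ‖z‖` absorb the error term in the component along `e`.
  set b : ℝ := c / (2 * (‖(τ : X)‖ + 1)) with hb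
  have hb0 : 0 < b := by positivity
  obtain ⟨j, hj⟩ := exists_nat_one_div_lt (lt_min hδ (lt_min (div_pos hs₀ hD0) hb0))
  refine ⟨j, fun r s hr hrj hs hsj => ?_⟩
  have hrδ : r < δ := (hrj.trans hj).trans_le (min_le_left _ _)
  have hsD : s < s₀ / D := (hsj.trans hj).trans_le ((min_le_right _ _).trans (min_le_left _ _))
  have hsb : s < b := (hsj.trans hj).trans_le ((min_le_right _ _).trans (min_le_right _ _))
  have hmeas : MeasurableSet (sector τ (D * s) r) :=
    ((isOpen_lt continuous_const continuous_snd).inter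
      ((isOpen_lt continuous_snd continuous_const).inter
      (isOpen_lt (by fun_prop : Continuous fun p : V × ℝ => ‖p.1 - τ‖)
        continuous_const))).measurableSet
  calc _ ≤ β (sector τ (D * s) r) := by
        rw [hβapp _ hmeas]
        refine measure_mono fun z hz => ?_
        obtain ⟨hzr, hzs, hzc⟩ := hz
        have hz0 : 0 < ‖z‖ := by
          rcases (norm_nonneg z).eq_or_lt with h0 | h0
          · rw [← h0, mul_zero] at hzs
            exact absurd hzs (norm_nonneg _).not_gt
          · exact h0
        set w := V.starProjection z - (inner ℝ e z : ℝ) • (τ : X) with hwdef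
        have hwa : ‖w‖ ≤ a * (s * ‖z‖) := (le_norm_starProjection_householder heV τ z).trans
          (by gcongr)
        have hwa' : ‖w‖ < a * (s * ‖z‖) := (le_norm_starProjection_householder heV τ z).trans_lt
          (by gcongr)
        have h1 : c * ‖z‖ < a * |inner ℝ e z| + ‖(τ : X)‖ * (s * ‖z‖) := by
          refine hzc.trans_le ?_
          rw [inner_householder_unit he heV, abs_neg]
          refine (abs_add_le _ _).trans ?_
          rw [abs_mul, abs_div, abs_of_pos (by positivity : 0 < tilt (τ : X))]
          gcongr
          rw [div_le_iff₀ (by positivity)]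
          calc _ ≤ ‖(τ : X)‖ * ‖w‖ := abs_real_inner_le_norm _ _
            _ ≤ ‖(τ : X)‖ * (a * (s * ‖z‖)) := by gcongr
            _ = _ := by ring
        have h2 : ‖(τ : X)‖ * s ≤ c / 2 := by
          have : s * (2 * (‖(τ : X)‖ + 1)) < c := by
            rwa [hb, lt_div_iff₀ (by positivity)] at hsb
          nlinarith
        have h3 : c / 2 * ‖z‖ < a * |inner ℝ e z| := by nlinarith
        have hez : 0 < |inner ℝ e z| := by
          by_contra hcon
          have : |inner ℝ e z| = 0 := le_antisymm (not_lt.1 hcon) (abs_nonneg _)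
          rw [this, mul_zero] at h3
          have : 0 < c / 2 * ‖z‖ := by positivity
          linarith
        have hez0 : (inner ℝ e z : ℝ) ≠ 0 := abs_pos.1 hez
        refine ⟨⟨hz0, hzr, ?_⟩, hez0⟩
        have h4 := hw τ z hez0
        rw [← hwdef] at h4
        have h5 : |inner ℝ e z| * ‖(f z).1 - τ‖ < |inner ℝ e z| * (D * s) := by
          rw [h4]
          refine hwa'.trans ?_
          have h6 : |inner ℝ e z| * (D * s) = (a * |inner ℝ e z|) * (2 / c * a * s) := by
            rw [hD]; ring
          have h7 : a * (s * ‖z‖) = (c / 2 * ‖z‖) * (2 / c * a * s) := by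
            field_simp
          rw [h6, h7]
          gcongr
        exact lt_of_mul_lt_mul_left h5 hez.le
    _ ≤ ENNReal.ofReal (1 / (i + 1) / D ^ k * (r * (D * s)) ^ k) :=
        h r (D * s) hr hrδ (by positivity) (by rwa [lt_div_iff₀ hD0, mul_comm] at hsD)
    _ = _ := by
        congr 1
        rw [show r * (D * s) = D * (r * s) by ring, mul_pow]
        field_simp

theorem tubeBound_map {X Y : Type*} [MeasurableSpace X] [MeasurableSpace Y] {k : ℕ} {ν : Measure X}
    {f : X → Y} (hf : Measurable f) {S : ℝ → Set Y} (hS : ∀ ρ, MeasurableSet (S ρ)) :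
    TubeBound k (ν.map f) S ↔ TubeBound k ν (fun ρ => f ⁻¹' S ρ) := by
  simp only [TubeBound, Measure.map_apply hf (hS _)]

theorem thinCone_map {X Y : Type*} [MeasurableSpace X] [MeasurableSpace Y] {k : ℕ} {ν : Measure X}
    {f : X → Y} (hf : Measurable f) {C : ℝ → ℝ → Set Y} (hC : ∀ r s, MeasurableSet (C r s)) :
    ThinCone k (ν.map f) C ↔ ThinCone k ν (fun r s => f ⁻¹' C r s) := by
  simp only [ThinCone, Measure.map_apply hf (hC _ _)]

/-- A cone covered by finitely many thin cones is thin. -/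
theorem ThinCone.of_subset_iUnion {X ι : Type*} [MeasurableSpace X] [Fintype ι] {k : ℕ}
    {ν : Measure X} {C : ℝ → ℝ → Set X} {D : ι → ℝ → ℝ → Set X} {s₀ : ℝ} (hs₀ : 0 < s₀)
    (h : ∀ r s, s < s₀ → C r s ⊆ ⋃ a, D a r s) (hD : ∀ a, ThinCone k ν (D a)) :
    ThinCone k ν C := by
  intro i
  -- Smallness sharpened by the number of pieces, so that the sum stays below `1 / (i + 1)`.
  set i' : ℕ := Fintype.card ι * (i + 1) with hi'
  choose j hj using fun a => hD a i'
  obtain ⟨j₀, hj₀⟩ := exists_nat_one_div_lt hs₀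
  have hle : ∀ a b : ℕ, a ≤ b → (1 : ℝ) / (b + 1) ≤ 1 / (a + 1) := fun a b hab => by
    have : (a : ℝ) ≤ b := by exact_mod_cast hab
    gcongr
  refine ⟨max j₀ (Finset.univ.sup j), fun r s hr hrj hs hsj => ?_⟩
  calc ν (C r s) ≤ ν (⋃ a, D a r s) := measure_mono (h r s
        ((hsj.trans_le (hle _ _ (le_max_left _ _))).trans hj₀))
    _ ≤ ∑ a, ν (D a r s) := measure_iUnion_fintype_le _ _
    _ ≤ ∑ _a : ι, ENNReal.ofReal (1 / (i' + 1) * (r * s) ^ k) := by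
        refine Finset.sum_le_sum fun a _ => ?_
        have ha : j a ≤ max j₀ (Finset.univ.sup j) :=
          (Finset.le_sup (Finset.mem_univ a)).trans (le_max_right _ _)
        exact hj a r s hr (hrj.trans_le (hle _ _ ha)) hs (hsj.trans_le (hle _ _ ha))
    _ = ENNReal.ofReal (Fintype.card ι * (1 / (i' + 1) * (r * s) ^ k)) := by
        rw [Finset.sum_const, Finset.card_univ, nsmul_eq_mul, ENNReal.ofReal_mul
          (Nat.cast_nonneg (Fintype.card ι)), ENNReal.ofReal_natCast]
    _ ≤ _ := by
        refine ENNReal.ofReal_le_ofReal ?_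
        rw [← mul_assoc]
        gcongr
        rw [hi', mul_one_div]
        push_cast
        rw [div_le_div_iff₀ (by positivity) (by positivity)]
        linarith

/-! ### Averaging over the orthogonal group -/

instance (n : ℕ) : (haarO n).IsHaarMeasure := by unfold haarO; infer_instance

/-- A compact group is unimodular: a right translate is again a Haar probability measure, and that
is unique. -/
instance (n : ℕ) : (haarO n).IsMulRightInvariant where
  map_mul_right_eq_self g := by
    have : IsProbabilityMeasure ((haarO n).map (· * g)) :=
      Measure.isProbabilityMeasure_map (measurable_mul_const g).aemeasurable
    have : ((haarO n).map (· * g)).IsHaarMeasure :=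
      Measure.isHaarMeasure_of_isCompact_nonempty_interior _ univ isCompact_univ (by simp)
        (by simp) (by simp)
    exact Measure.isHaarMeasure_eq_of_isProbabilityMeasure _ _

theorem norm_unitary_apply {n : ℕ} (g : O n) (z : E n) : ‖(g : E n →L[ℝ] E n) z‖ = ‖z‖ :=
  (Unitary.linearIsometryEquiv g).norm_map z

theorem norm_star_unitary_apply {n : ℕ} (g : O n) (z : E n) :
    ‖(star (g : E n →L[ℝ] E n)) z‖ = ‖z‖ := by
  rw [← Unitary.coe_star]; exact norm_unitary_apply _ z

/-- The reflection `householder e τ` as an element of `O(n)`. -/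
noncomputable def householderO {n : ℕ} {V : Submodule ℝ (E n)} {e : E n} (he : ‖e‖ = 1)
    (heV : e ∈ Vᗮ) (τ : V) : O n :=
  ⟨householder e (τ : E n), by
    have h1 : star (householder e (τ : E n)) = householder e (τ : E n) := by
      refine ((ContinuousLinearMap.eq_adjoint_iff _ _).2 fun x y => ?_).symm
      exact inner_householder e _ x y
    have h2 : householder e (τ : E n) * householder e (τ : E n) = 1 := by
      ext1 z
      exact householder_householder he (Submodule.inner_right_of_mem_orthogonal τ.2 heV) z
    exact Unitary.mem_iff.2 ⟨by rw [h1, h2], by rw [h1, h2]⟩⟩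

theorem star_mul_householderO {n : ℕ} {V : Submodule ℝ (E n)} {e : E n} (he : ‖e‖ = 1)
    (heV : e ∈ Vᗮ) (τ : V) (g : O n) (z : E n) :
    (star ((g * householderO he heV τ : O n) : E n →L[ℝ] E n)) z
      = householder e (τ : E n) ((star (g : E n →L[ℝ] E n)) z) := by
  have h1 : star (householder e (τ : E n)) = householder e (τ : E n) :=
    ((ContinuousLinearMap.eq_adjoint_iff _ _).2 fun x y => inner_householder e _ x y).symm
  change (star ((g : E n →L[ℝ] E n) * householder e (τ : E n))) z = _
  rw [star_mul, h1]
  rfl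

theorem continuous_householderO {n : ℕ} {V : Submodule ℝ (E n)} {e : E n} (he : ‖e‖ = 1)
    (heV : e ∈ Vᗮ) : Continuous (householderO (V := V) he heV) :=
  Continuous.subtype_mk ((continuous_householder e).comp continuous_subtype_val) _

/-- For almost every rotation of `V`, thin cones around the fibre of the projection, in the
directions near a rotated fixed normal vector, have small mass. -/
theorem ae_haarO_thinCone_direction {n : ℕ} {V : Submodule ℝ (E n)}
    (hV : 0 < Module.finrank ℝ V) {e : E n} (he : ‖e‖ = 1) (heV : e ∈ Vᗮ) (ν : Measure (E n))
    [IsFiniteMeasure ν] {c : ℝ} (hc : 0 < c) :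
    ∀ᵐ (g : O n) ∂haarO n, TubeBound (Module.finrank ℝ V) ν
        (fun ρ => {z | ‖V.starProjection ((star (g : E n →L[ℝ] E n)) z)‖ < ρ}) →
      ThinCone (Module.finrank ℝ V) ν (fun r s => {z | ‖z‖ < r ∧
        ‖V.starProjection ((star (g : E n →L[ℝ] E n)) z)‖ < s * ‖z‖ ∧
        c * ‖z‖ < |inner ℝ e ((star (g : E n →L[ℝ] E n)) z)|}) := by
  set good : O n → Prop := fun g => TubeBound (Module.finrank ℝ V) ν
        (fun ρ => {z | ‖V.starProjection ((star (g : E n →L[ℝ] E n)) z)‖ < ρ}) →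
      ThinCone (Module.finrank ℝ V) ν (fun r s => {z | ‖z‖ < r ∧
        ‖V.starProjection ((star (g : E n →L[ℝ] E n)) z)‖ < s * ‖z‖ ∧
        c * ‖z‖ < |inner ℝ e ((star (g : E n →L[ℝ] E n)) z)|}) with hgood
  have hgm : MeasurableSet {g | good g} := by
    simp only [hgood, imp_iff_not_or]
    refine (MeasurableSet.compl ?_).union ?_
    · refine measurableSet_tubeBound _ ν _ fun ρ => ?_
      exact isOpen_lt (by fun_prop : Continuous fun q : O n × E n =>
        ‖V.starProjection ((star (q.1 : E n →L[ℝ] E n)) q.2)‖) continuous_const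
    · refine measurableSet_thinCone _ ν _ fun r s => ?_
      refine (isOpen_lt (by fun_prop : Continuous fun q : O n × E n => ‖q.2‖)
        continuous_const).inter ((isOpen_lt (by fun_prop : Continuous fun q : O n × E n =>
        ‖V.starProjection ((star (q.1 : E n →L[ℝ] E n)) q.2)‖)
        (by fun_prop : Continuous fun q : O n × E n => s * ‖q.2‖)).inter
        (isOpen_lt (by fun_prop : Continuous fun q : O n × E n => c * ‖q.2‖)
        (by fun_prop : Continuous fun q : O n × E n =>
          |inner ℝ e ((star (q.1 : E n →L[ℝ] E n)) q.2)|)))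
  have hrot : ∀ g : O n, ∀ᵐ τ : V, good (g * householderO he heV τ) := by
    intro g
    have hf : Measurable fun z : E n => (star (g : E n →L[ℝ] E n)) z :=
      Continuous.measurable (by fun_prop)
    filter_upwards [ae_thinCone_householder hV he heV
      (ν.map fun z : E n => (star (g : E n →L[ℝ] E n)) z) hc] with τ hτ
    rw [tubeBound_map hf, thinCone_map hf] at hτ
    · simp only [hgood, star_mul_householderO]
      simpa only [preimage_ofPred_eq, norm_star_unitary_apply] using hτ
    · intro r s
      have h1 : Continuous fun z : E n => ‖V.starProjection (householder e (τ : E n) z)‖ := by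
        fun_prop
      have h2 : Continuous fun z : E n => |inner ℝ e (householder e (τ : E n) z)| := by
        fun_prop
      exact ((isOpen_lt continuous_norm continuous_const).inter
        ((isOpen_lt h1 (continuous_const.mul continuous_norm)).inter
        (isOpen_lt (continuous_const.mul continuous_norm) h2))).measurableSet
    · exact fun ρ => (isOpen_lt (by fun_prop) continuous_const).measurableSet
  have hcont : Continuous fun p : O n × V => p.1 * householderO he heV p.2 :=
    continuous_fst.mul ((continuous_householderO he heV).comp continuous_snd)
  -- Fubini produces a single `τ` for which `g * householderO he heV τ` is good for almost every
  -- `g`; right invariance then removes the fixed factor.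
  have hswap := (Measure.ae_ae_comm (μ := haarO n) (ν := (volume : Measure V))
    (p := fun g τ => good (g * householderO he heV τ)) (hcont.measurable hgm)).1
    (Eventually.of_forall hrot)
  obtain ⟨τ, hτ⟩ := hswap.exists
  rw [ae_iff] at hτ ⊢
  rw [← measure_preimage_mul_right (haarO n) (householderO he heV τ)]
  exact hτ

/-- For almost every rotation of `V`, if slabs around the fibre of the projection have mass of
the order of their width, then thin cones around it have small mass. -/
theorem ae_haarO_thinCone {n : ℕ} {V : Submodule ℝ (E n)}
    (hV : 0 < Module.finrank ℝ V) (ν : Measure (E n)) [IsFiniteMeasure ν] :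
    ∀ᵐ (g : O n) ∂haarO n, TubeBound (Module.finrank ℝ V) ν
        (fun ρ => {z | ‖V.starProjection ((star (g : E n →L[ℝ] E n)) z)‖ < ρ}) →
      ThinCone (Module.finrank ℝ V) ν (fun r s => {z | ‖z‖ < r ∧
        ‖V.starProjection ((star (g : E n →L[ℝ] E n)) z)‖ < s * ‖z‖}) := by
  set b := stdOrthonormalBasis ℝ Vᗮ
  set d := Module.finrank ℝ Vᗮ
  -- Chosen so that `d c² ≤ 1/4`; the `+ 1` covers `d = 0`.
  set c : ℝ := 1 / (2 * √(d + 1)) with hc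
  have hc0 : 0 < c := by positivity
  have hc2 : d * c ^ 2 ≤ 1 / 4 := by
    rw [hc, div_pow, mul_pow, Real.sq_sqrt (by positivity), one_pow, mul_one_div, div_le_div_iff₀
      (by positivity) (by positivity)]
    linarith
  have hb : ∀ a, ‖(b a : E n)‖ = 1 := fun a => b.norm_eq_one a
  have hall : ∀ᵐ (g : O n) ∂haarO n, ∀ a, TubeBound (Module.finrank ℝ V) ν
        (fun ρ => {z | ‖V.starProjection ((star (g : E n →L[ℝ] E n)) z)‖ < ρ}) →
      ThinCone (Module.finrank ℝ V) ν (fun r s => {z | ‖z‖ < r ∧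
        ‖V.starProjection ((star (g : E n →L[ℝ] E n)) z)‖ < s * ‖z‖ ∧
        c * ‖z‖ < |inner ℝ (b a : E n) ((star (g : E n →L[ℝ] E n)) z)|}) :=
    ae_all_iff.2 fun a => ae_haarO_thinCone_direction hV (hb a) (b a).2 ν hc0
  filter_upwards [hall] with g hg hT
  -- For `s < 1/2` a vector of the cone has a component larger than `c ‖z‖` along some basis vector
  -- of `Vᗮ`; otherwise `‖ζ‖² ≤ ‖z‖²/4 + ‖z‖²/4`.
  refine ThinCone.of_subset_iUnion (s₀ := 1 / 2) (by norm_num) (fun r s hs z hz => ?_)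
    fun a => hg a hT
  obtain ⟨hzr, hzs⟩ := hz
  set ζ := (star (g : E n →L[ℝ] E n)) z with hζ
  have hnorm : ‖ζ‖ = ‖z‖ := norm_star_unitary_apply g z
  have hz0 : 0 < ‖z‖ := by
    rcases (norm_nonneg z).eq_or_lt with h0 | h0
    · rw [← h0, mul_zero] at hzs
      exact absurd hzs (norm_nonneg _).not_gt
    · exact h0
  by_contra hcon
  simp only [mem_iUnion, not_exists] at hcon
  have hsmall : ∀ a, ‖(inner ℝ (b a) (Vᗮ.orthogonalProjectionOnto ζ) : ℝ)‖ ^ 2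
      ≤ c ^ 2 * ‖z‖ ^ 2 := by
    intro a
    have h1 : |inner ℝ (b a : E n) ζ| ≤ c * ‖z‖ := by
      by_contra h
      exact hcon a ⟨hzr, hzs, not_le.1 h⟩
    have h2 : inner ℝ (b a) (Vᗮ.orthogonalProjectionOnto ζ) = inner ℝ (b a : E n) ζ :=
      Submodule.inner_orthogonalProjectionOnto_eq_of_mem_left _ _
    rw [h2, Real.norm_eq_abs, ← mul_pow]
    gcongr
  have h1 := Submodule.norm_sq_eq_add_norm_sq_projection ζ V
  have h2 : ‖Vᗮ.orthogonalProjectionOnto ζ‖ ^ 2 ≤ 1 / 4 * ‖z‖ ^ 2 := by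
    rw [← b.sum_sq_norm_inner_right]
    refine (Finset.sum_le_sum fun a _ => hsmall a).trans ?_
    rw [Finset.sum_const, Finset.card_univ, Fintype.card_fin, nsmul_eq_mul, ← mul_assoc]
    gcongr
  have h3 : ‖V.orthogonalProjectionOnto ζ‖ ≤ 1 / 2 * ‖z‖ := by
    have : ‖V.starProjection ζ‖ < s * ‖z‖ := hzs
    have h4 : ‖V.starProjection ζ‖ = ‖V.orthogonalProjectionOnto ζ‖ := rfl
    rw [h4] at this
    nlinarith
  have h5 : ‖V.orthogonalProjectionOnto ζ‖ ^ 2 ≤ (1 / 2 * ‖z‖) ^ 2 := by gcongr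
  rw [hnorm] at h1
  nlinarith [sq_pos_of_pos hz0]

/-! ### Thin cones for almost every plane -/

/-- The cone with vertex `x`, radius `r` and aperture `s` around the kernel of `p`. -/
def cone {n : ℕ} (p : E n →L[ℝ] E n) (x : E n) (r s : ℝ) : Set (E n) :=
  {z | ‖z - x‖ < r ∧ ‖p (z - x)‖ < s * ‖z - x‖}

/-- If the slabs around the fibre of `p` through `x` have mass of the order of their width, then
the thin cones around this fibre have small mass. -/
def ThinConesAt {n : ℕ} (k : ℕ) (μ : Measure (E n)) (x : E n) (p : E n →L[ℝ] E n) : Prop :=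
  TubeBound k μ (fun ρ => {z | ‖p (z - x)‖ < ρ}) → ThinCone k μ (cone p x)

theorem isOpen_cone {n : ℕ} (p : E n →L[ℝ] E n) (r s : ℝ) :
    IsOpen {q : E n × E n | q.2 ∈ cone p q.1 r s} :=
  (isOpen_lt (by fun_prop : Continuous fun q : E n × E n => ‖q.2 - q.1‖) continuous_const).inter
    (isOpen_lt (by fun_prop : Continuous fun q : E n × E n => ‖p (q.2 - q.1)‖)
      (by fun_prop : Continuous fun q : E n × E n => s * ‖q.2 - q.1‖))

theorem measurableSet_thinConesAt {n : ℕ} (k : ℕ) (μ : Measure (E n)) :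
    MeasurableSet {q : E n × (E n →L[ℝ] E n) | ThinConesAt k μ q.1 q.2} := by
  simp only [ThinConesAt, imp_iff_not_or]
  have h1 : Continuous fun q : (E n × (E n →L[ℝ] E n)) × E n => ‖q.1.2 (q.2 - q.1.1)‖ := by
    fun_prop
  have h2 : Continuous fun q : (E n × (E n →L[ℝ] E n)) × E n => ‖q.2 - q.1.1‖ := by fun_prop
  refine (MeasurableSet.compl ?_).union ?_
  · exact measurableSet_tubeBound k μ _ fun ρ => isOpen_lt h1 continuous_const
  · exact measurableSet_thinCone k μ _ fun r s =>
      (isOpen_lt h2 continuous_const).inter (isOpen_lt h1 (continuous_const.mul h2))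

theorem norm_starProjection_rotate {n m : ℕ} (g : O n) (V : Gr n m) (z : E n) :
    ‖(rotate g V).plane.starProjection z‖
      = ‖V.plane.starProjection ((star (g : E n →L[ℝ] E n)) z)‖ := by
  have h : (rotate g V).plane.starProjection z
      = (g : E n →L[ℝ] E n) (V.plane.starProjection ((star (g : E n →L[ℝ] E n)) z)) :=
    Submodule.starProjection_map_apply (Unitary.linearIsometryEquiv g) V.plane z
  rw [h, norm_unitary_apply]

theorem continuous_starProjection_plane {n m : ℕ} :
    Continuous fun V : Gr n m => V.plane.starProjection := continuous_induced_dom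

/-- For almost every plane `V`, at almost every point whose slabs over small balls of `V` have mass
of the order of their width, the thin cones around the fibre of `π_V` have small mass. -/
theorem ae_thinConesAt {n m : ℕ} (hm : 0 < m) (h : m ≤ n) (μ : Measure (E n))
    [IsFiniteMeasure μ] :
    ∀ᵐ V ∂grassmannMeasure n m h, ∀ᵐ x ∂μ, ThinConesAt m μ x V.plane.starProjection := by
  have hmeas := measurableSet_thinConesAt m μ
  have hset : MeasurableSet {V : Gr n m | ∀ᵐ x ∂μ, ThinConesAt m μ x V.plane.starProjection} := by
    have h1 : Measurable fun p : E n →L[ℝ] E n => μ ((fun x => (x, p)) ⁻¹'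
        {q : E n × (E n →L[ℝ] E n) | ThinConesAt m μ q.1 q.2}ᶜ) :=
      measurable_measure_prodMk_right hmeas.compl
    exact (h1.comp continuous_starProjection_plane.measurable) (measurableSet_singleton 0)
  rw [grassmannMeasure, ae_map_iff (continuous_rotate _).measurable.aemeasurable hset]
  set V₀ := coordPlane n m h
  have hcont : Continuous fun q : O n × E n => (q.2, (rotate q.1 V₀).plane.starProjection) :=
    continuous_snd.prodMk (continuous_starProjection_plane.comp
      ((continuous_rotate V₀).comp continuous_fst))
  -- After the exchange of quantifiers the vertex `x` is fixed and is translated to the origin.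
  refine (Measure.ae_ae_comm (μ := haarO n) (ν := μ)
    (p := fun g x => ThinConesAt m μ x (rotate g V₀).plane.starProjection)
    (hcont.measurable hmeas)).2 (Eventually.of_forall fun x => ?_)
  have hf : Measurable fun z : E n => z - x := by fun_prop
  have hae := ae_haarO_thinCone (V := V₀.plane) (by rw [V₀.finrank_eq]; exact hm)
    (μ.map fun z : E n => z - x)
  rw [V₀.finrank_eq] at hae
  filter_upwards [hae] with g hg
  have h1 : Continuous fun z : E n => ‖V₀.plane.starProjection ((star (g : E n →L[ℝ] E n)) z)‖ := by
    fun_prop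
  have h2 : ∀ r s : ℝ, MeasurableSet {z : E n | ‖z‖ < r ∧
      ‖V₀.plane.starProjection ((star (g : E n →L[ℝ] E n)) z)‖ < s * ‖z‖} := fun r s =>
    ((isOpen_lt continuous_norm continuous_const).inter
      (isOpen_lt h1 (continuous_const.mul continuous_norm))).measurableSet
  rw [tubeBound_map hf fun ρ => (isOpen_lt h1 continuous_const).measurableSet,
    thinCone_map hf h2] at hg
  have hcone : cone (rotate g V₀).plane.starProjection x = fun r s => {z | ‖z - x‖ < r ∧
      ‖V₀.plane.starProjection ((star (g : E n →L[ℝ] E n)) (z - x))‖ < s * ‖z - x‖} := by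
    funext r s
    simp only [cone, norm_starProjection_rotate]
  simp only [ThinConesAt, hcone, norm_starProjection_rotate]
  exact hg

/-! ### Small cones force bi-Lipschitz projections -/

/-- A set on which the projection `p` is proportional to the distance in thin slabs: if cones with
vertices in `S` have small mass while `S` has mass of the order of `ρ ^ k` in slabs around the fibre
through `x ∈ S`, then `S` does not meet the thin cone at `x`. -/
theorem le_norm_of_small_cones {n k : ℕ} {μ : Measure (E n)} {p : E n →L[ℝ] E n} {S : Set (E n)}
    {δ l c ρ₀ s : ℝ}
    (hcone : ∀ y ∈ S, ∀ r σ : ℝ, 0 < r → r < δ → 0 < σ → σ < δ →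
      μ (cone p y r σ) ≤ ENNReal.ofReal (l * (r * σ) ^ k))
    {x : E n} (hx : x ∈ S)
    (hlow : ∀ ρ : ℝ, 0 < ρ → ρ < ρ₀ →
      ENNReal.ofReal (c * ρ ^ k) ≤ μ (S ∩ {w | ‖p (w - x)‖ ≤ ρ}))
    {d : ℝ} (hdiam : ∀ y ∈ S, ∀ z ∈ S, ‖z - y‖ ≤ d) (hd : 3 * d < δ) (hd1 : d ≤ 1)
    (hs : 0 < s) (hsδ : 2 * s < δ) (hsρ : s < ρ₀) (hl : 0 ≤ l) (hlc : 2 * (l * 48 ^ k) < c) :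
    ∀ z ∈ S, s * ‖z - x‖ ≤ ‖p (z - x)‖ := by
  by_contra! hcon
  obtain ⟨z₀, hz₀S, hz₀⟩ := hcon
  -- The distances from `x` to the points of `S` in its thin cone. A nearly farthest such point `z`
  -- serves as the second vertex.
  set Z : Set ℝ := (fun z => ‖z - x‖) '' {z ∈ S | ‖p (z - x)‖ < s * ‖z - x‖} with hZ
  have hZne : Z.Nonempty := ⟨_, z₀, ⟨hz₀S, hz₀⟩, rfl⟩
  have hZbdd : BddAbove Z := ⟨d, by rintro _ ⟨z, hz, rfl⟩; exact hdiam x hx z hz.1⟩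
  set h := sSup Z with hh
  have hpos₀ : 0 < ‖z₀ - x‖ := by
    rcases (norm_nonneg (z₀ - x)).eq_or_lt with h0 | h0
    · rw [← h0, mul_zero] at hz₀
      exact absurd hz₀ (norm_nonneg _).not_gt
    · exact h0
  have hh0 : 0 < h := hpos₀.trans_le (le_csSup hZbdd ⟨z₀, ⟨hz₀S, hz₀⟩, rfl⟩)
  have hhd : h ≤ d := csSup_le hZne (by rintro _ ⟨z, hz, rfl⟩; exact hdiam x hx z hz.1)
  obtain ⟨_, ⟨z, ⟨hzS, hzp⟩, rfl⟩, hzh⟩ := exists_lt_of_lt_csSup hZne (half_lt_self hh0)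
  simp only at hzh
  have hzle : ‖z - x‖ ≤ h := le_csSup hZbdd ⟨z, ⟨hzS, hzp⟩, rfl⟩
  -- A point of the slab farther than `h / 8` from `x` is in the cone at `x`, hence within `h`. A
  -- nearer one is at distance more than `3 h / 8` from `z`, hence in the cone at `z` of doubled
  -- aperture.
  have hsub : S ∩ {w | ‖p (w - x)‖ ≤ s * h / 8}
      ⊆ cone p x (3 * h) (2 * s) ∪ cone p z (3 * h) (2 * s) := by
    rintro w ⟨hwS, hw⟩
    have hw : ‖p (w - x)‖ ≤ s * h / 8 := hw
    by_cases hwx : h / 8 < ‖w - x‖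
    · left
      have h1 : ‖p (w - x)‖ < s * ‖w - x‖ := hw.trans_lt (by nlinarith)
      have h2 : ‖w - x‖ ≤ h := le_csSup hZbdd ⟨w, ⟨hwS, h1⟩, rfl⟩
      exact ⟨by linarith, h1.trans_le (by nlinarith [norm_nonneg (w - x)])⟩
    · right
      rw [not_lt] at hwx
      have h1 : ‖w - z‖ ≤ ‖w - x‖ + ‖z - x‖ := by
        rw [show w - z = (w - x) - (z - x) by abel]; exact norm_sub_le _ _
      have h2 : ‖z - x‖ ≤ ‖w - x‖ + ‖w - z‖ := by
        rw [show z - x = (w - x) - (w - z) by abel]; exact norm_sub_le _ _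
      have h3 : ‖p (w - z)‖ ≤ ‖p (w - x)‖ + ‖p (z - x)‖ := by
        rw [show w - z = (w - x) - (z - x) by abel, map_sub]; exact norm_sub_le _ _
      exact ⟨by linarith, h3.trans_lt (by nlinarith)⟩
  have h1 := hlow (s * h / 8) (by positivity) (by nlinarith)
  have h2 := hcone x hx (3 * h) (2 * s) (by positivity) (by linarith) (by positivity) hsδ
  have h3 := hcone z hzS (3 * h) (2 * s) (by positivity) (by linarith) (by positivity) hsδ
  have h4 : ENNReal.ofReal (c * (s * h / 8) ^ k)
      ≤ ENNReal.ofReal (2 * (l * (3 * h * (2 * s)) ^ k)) := by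
    refine h1.trans ((measure_mono hsub).trans ((measure_union_le _ _).trans
      ((add_le_add h2 h3).trans ?_)))
    rw [← ENNReal.ofReal_add (by positivity) (by positivity), ← two_mul]
  rw [ENNReal.ofReal_le_ofReal_iff (by positivity)] at h4
  -- The ratio of radius times aperture to the slab width is `48`, whence the condition `hlc`.
  have h5 : 3 * h * (2 * s) = 48 * (s * h / 8) := by ring
  rw [h5, mul_pow, ← mul_assoc l, ← mul_assoc 2] at h4
  exact absurd (le_of_mul_le_mul_right h4 (by positivity)) hlc.not_ge

theorem lipschitzWith_proj {n m : ℕ} (V : Gr n m) : LipschitzWith 1 (proj V) :=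
  V.plane.lipschitzWith_orthogonalProjectionOnto

/-- A bounded closed set on which `π_V` is bi-Lipschitz is rectifiable. -/
theorem countablyRectifiable_of_le_norm {n m : ℕ} (V : Gr n m) {C : Set (E n)} (hC : IsClosed C)
    (hb : Bornology.IsBounded C) {s : ℝ} (hs : 0 < s)
    (h : ∀ x ∈ C, ∀ z ∈ C, s * ‖z - x‖ ≤ ‖V.plane.starProjection (z - x)‖) :
    CountablyRectifiable m C := by
  let I : V.plane ≃ₗᵢ[ℝ] E m :=
    ((stdOrthonormalBasis ℝ V.plane).reindex (finCongr V.finrank_eq)).repr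
  let q : E n → E m := fun x => I (proj V x)
  have hq : ∀ x ∈ C, ∀ z ∈ C, dist z x ≤ s⁻¹ * dist (q z) (q x) := by
    intro x hx z hz
    have h1 : dist (q z) (q x) = ‖V.plane.starProjection (z - x)‖ := by
      simp only [q, proj]
      rw [I.dist_map, dist_eq_norm, ← map_sub]
      rfl
    rw [h1, dist_eq_norm, ← div_eq_inv_mul, le_div_iff₀ hs, mul_comm]
    exact h x hx z hz
  have hinj : InjOn q C := fun x hx z hz hxz => by
    have := hq z hz x hx
    rw [hxz, dist_self, mul_zero] at this
    exact dist_le_zero.1 this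
  have hleft : LeftInvOn (Function.invFunOn q C) q C := hinj.leftInvOn_invFunOn
  refine ⟨hC.measurableSet, fun _ => q '' C, fun _ => Function.invFunOn q C, fun _ => ?_,
    fun _ => ⟨(s⁻¹).toNNReal, ?_⟩, ?_⟩
  · have hLip : LipschitzWith 1 q := by
      have h2 := I.lipschitz.comp (lipschitzWith_proj V)
      rwa [one_mul] at h2
    exact hLip.isBounded_image hb
  · refine LipschitzOnWith.of_dist_le_mul ?_
    rintro _ ⟨x, hx, rfl⟩ _ ⟨z, hz, rfl⟩
    change dist (Function.invFunOn q C (q x)) (Function.invFunOn q C (q z)) ≤ _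
    rw [hleft hx, hleft hz, Real.coe_toNNReal _ (by positivity)]
    exact hq z hz x hx
  · rw [iUnion_const, hleft.image_image]

/-! ### Atoms of the disintegration -/

theorem PurelyAtomic.measure_setOf_eq_zero {n : ℕ} {ν : Measure (E n)} (h : PurelyAtomic ν) :
    ν {x | ν {x} = 0} = 0 := by
  obtain ⟨S, hS, hS0⟩ := h
  refine measure_mono_null (t := Sᶜ ∪ ⋃ x ∈ S ∩ {x | ν {x} = 0}, {x}) (fun x hx => ?_)
    (measure_union_null hS0 ((measure_biUnion_null_iff (hS.mono inter_subset_left)).2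
      fun x hx => hx.2))
  by_cases hxS : x ∈ S
  · exact Or.inr (mem_biUnion ⟨hxS, hx⟩ rfl)
  · exact Or.inl hxS

theorem continuous_proj {n m : ℕ} (V : Gr n m) : Continuous (proj V) :=
  (lipschitzWith_proj V).continuous

theorem norm_proj_sub {n m : ℕ} (V : Gr n m) (x z : E n) :
    ‖proj V z - proj V x‖ = ‖V.plane.starProjection (z - x)‖ := by
  simp only [proj, ← map_sub]; rfl

instance {n m : ℕ} (V : Gr n m) (μ : Measure (E n)) [IsFiniteMeasure μ] :
    IsFiniteMeasure (projMeasure V μ) := by unfold projMeasure; infer_instance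

instance {n m : ℕ} (V : Gr n m) : (μH[m] : Measure V.plane).IsAddHaarMeasure := by
  have h := isAddHaarMeasure_hausdorffMeasure (E := V.plane)
  rwa [V.finrank_eq] at h

/-- The diagonal is measurable, and the function is the kernel measure of its slices. -/
theorem measurable_atom {n m : ℕ} (V : Gr n m) (κ : Kernel V.plane (E n)) [IsMarkovKernel κ] :
    Measurable fun x : E n => κ (proj V x) {x} := by
  have h1 := Kernel.measurable_kernel_prodMk_left (κ := κ.comap (proj V)
    (continuous_proj V).measurable) (t := {q : E n × E n | q.2 = q.1})
    (measurableSet_eq_fun measurable_snd measurable_fst)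
  exact h1

/-- A disintegration bounds from below the projection of the restriction of `μ` to `F`. -/
theorem withDensity_le_projMeasure {n m : ℕ} {V : Gr n m} {μ : Measure (E n)} [IsFiniteMeasure μ]
    {κ : Kernel V.plane (E n)} (hκ : IsDisintegration V μ κ) (H : Measure V.plane) [SigmaFinite H]
    {F : Set (E n)} (hF : MeasurableSet F) :
    H.withDensity (fun y => (projMeasure V μ).rnDeriv H y * κ y F)
      ≤ projMeasure V (μ.restrict F) := by
  have := hκ.isMarkov
  have hκF : Measurable fun y => κ y F := κ.measurable_coe hF
  have hrn : Measurable ((projMeasure V μ).rnDeriv H) := Measure.measurable_rnDeriv _ _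
  refine Measure.le_iff.2 fun W hW => ?_
  have hW' : MeasurableSet (proj V ⁻¹' W) := (continuous_proj V).measurable hW
  have happ : projMeasure V (μ.restrict F) W
      = ∫⁻ y, κ y (proj V ⁻¹' W ∩ F) ∂(projMeasure V μ) := by
    rw [← hκ.measure_eq _ (hW'.inter hF), ← Measure.restrict_apply hW']
    exact Measure.map_apply (continuous_proj V).measurable hW
  rw [happ, withDensity_apply _ hW]
  calc ∫⁻ y in W, (projMeasure V μ).rnDeriv H y * κ y F ∂H
      = ∫⁻ y in W, κ y F ∂(H.withDensity ((projMeasure V μ).rnDeriv H)) := by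
        rw [setLIntegral_withDensity_eq_setLIntegral_mul _ hrn hκF hW]
        rfl
    -- The singular part of `π_V μ` is discarded here; hence only an inequality.
    _ ≤ ∫⁻ y in W, κ y F ∂(projMeasure V μ) :=
        lintegral_mono' (Measure.restrict_mono le_rfl (Measure.withDensity_rnDeriv_le _ _)) le_rfl
    _ ≤ ∫⁻ y, κ y (proj V ⁻¹' W ∩ F) ∂(projMeasure V μ) := by
        rw [← lintegral_indicator hW]
        refine lintegral_mono_ae ?_
        filter_upwards [hκ.concentrated] with y hy
        by_cases hyW : y ∈ W
        · rw [indicator_of_mem hyW]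
          calc κ y F ≤ κ y ((proj V ⁻¹' W ∩ F) ∪ (proj V ⁻¹' {y})ᶜ) := by
                refine measure_mono fun x hx => ?_
                by_cases hxy : proj V x = y
                · exact Or.inl ⟨by rw [mem_preimage, hxy]; exact hyW, hx⟩
                · exact Or.inr hxy
            _ ≤ κ y (proj V ⁻¹' W ∩ F) + κ y (proj V ⁻¹' {y})ᶜ := measure_union_le _ _
            _ = _ := by rw [hy, add_zero]
        · rw [indicator_of_notMem hyW]; exact zero_le

/-- Almost every point over `W` is an atom of its slice, if the slices over `W` are atomic. -/
theorem ae_atom_ne_zero {n m : ℕ} {V : Gr n m} {μ : Measure (E n)}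
    {κ : Kernel V.plane (E n)} (hκ : IsDisintegration V μ κ) {W : Set V.plane}
    (hW : MeasurableSet W) (hat : ∀ᵐ y ∂(projMeasure V μ), y ∈ W → PurelyAtomic (κ y)) :
    ∀ᵐ x ∂μ, proj V x ∈ W → κ (proj V x) {x} ≠ 0 := by
  have := hκ.isMarkov
  have hmeas : MeasurableSet {x : E n | proj V x ∈ W ∧ κ (proj V x) {x} = 0} :=
    ((continuous_proj V).measurable hW).inter (measurable_atom V κ (measurableSet_singleton 0))
  have h0 : μ {x : E n | proj V x ∈ W ∧ κ (proj V x) {x} = 0} = 0 := by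
    rw [hκ.measure_eq _ hmeas]
    refine lintegral_eq_zero_of_ae_eq_zero ?_
    filter_upwards [hat, hκ.concentrated] with y hy hyc
    by_cases hyW : y ∈ W
    · refine measure_mono_null (t := {x | κ y {x} = 0} ∪ (proj V ⁻¹' {y})ᶜ) (fun x hx => ?_)
        (measure_union_null (hy hyW).measure_setOf_eq_zero hyc)
      by_cases hxy : proj V x = y
      · exact Or.inl (hxy ▸ hx.2)
      · exact Or.inr hxy
    · refine measure_mono_null (fun x hx => ?_) hyc
      intro hxy
      have hxy : proj V x = y := hxy
      exact hyW (hxy ▸ hx.1)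
  rw [measure_eq_zero_iff_ae_notMem] at h0
  filter_upwards [h0] with x hx hxW hx0
  exact hx ⟨hxW, hx0⟩

theorem exists_pos_measure_of_subset_iUnion {X : Type*} [MeasurableSpace X] {μ : Measure X}
    {A : Set X} (hA : μ A ≠ 0) {B : ℕ → Set X} (h : ∀ᵐ x ∂μ, x ∈ A → ∃ i, x ∈ B i) :
    ∃ i, μ (B i) ≠ 0 := by
  by_contra! hcon
  refine hA (measure_mono_null_ae ?_ (measure_iUnion_null hcon))
  filter_upwards [h] with x hx hxA
  exact mem_iUnion.2 (hx hxA)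

/-! ### Upper and lower bounds for slabs -/

/-- Slabs have mass of the order of their width at almost every point over the absolutely
continuous part of the projection. -/
theorem ae_tubeBound {n m : ℕ} (V : Gr n m) (μ : Measure (E n)) [IsFiniteMeasure μ]  :
    ∀ᵐ y ∂(μH[m] : Measure V.plane), ∀ x : E n, proj V x = y →
      TubeBound m μ (fun ρ => {z | ‖V.plane.starProjection (z - x)‖ < ρ}) := by
  set H : Measure V.plane := μH[m] with hH
  have hω0 : H (Metric.ball 0 1) ≠ 0 := (Metric.measure_ball_pos H _ one_pos).ne'
  have hωt : H (Metric.ball 0 1) ≠ ∞ := measure_ball_lt_top.ne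
  filter_upwards [Besicovitch.ae_tendsto_rnDeriv (projMeasure V μ) H,
    Measure.rnDeriv_lt_top (projMeasure V μ) H] with y hy hyt x hx
  obtain ⟨N₁, hN₁⟩ := ENNReal.exists_nat_gt hyt.ne
  obtain ⟨u, hu, hu'⟩ := mem_nhdsGT_iff_exists_Ioo_subset.1 (hy.eventually (gt_mem_nhds hN₁))
  obtain ⟨N₂, hN₂⟩ := exists_nat_one_div_lt (mem_Ioi.1 hu)
  obtain ⟨N₃, hN₃⟩ := exists_nat_ge (N₁ * (H (Metric.ball 0 1)).toReal)
  refine ⟨max N₂ N₃, fun ρ hρ hρN => ?_⟩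
  have hρu : ρ < u := by
    refine (hρN.trans_le ?_).trans hN₂
    have : (N₂ : ℝ) ≤ (max N₂ N₃ : ℕ) := by exact_mod_cast le_max_left _ _
    gcongr
  have h1 := hu' ⟨hρ, hρu⟩
  have h2 := (ENNReal.div_le_iff (Metric.measure_closedBall_pos H y hρ).ne'
    measure_closedBall_lt_top.ne).1 (le_of_lt h1)
  calc μ {z | ‖V.plane.starProjection (z - x)‖ < ρ}
      ≤ μ (proj V ⁻¹' Metric.closedBall y ρ) := by
        refine measure_mono fun z hz => ?_
        rw [mem_preimage, mem_closedBall_iff_norm, ← hx, norm_proj_sub]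
        exact le_of_lt hz
    _ = projMeasure V μ (Metric.closedBall y ρ) := by
        rw [projMeasure, Measure.map_apply (continuous_proj V).measurable
          Metric.isClosed_closedBall.measurableSet]
    _ ≤ N₁ * H (Metric.closedBall y ρ) := h2
    _ = ENNReal.ofReal (N₁ * (H (Metric.ball 0 1)).toReal * ρ ^ m) := by
        rw [addHaar_closedBall_eq H y hρ.le, V.finrank_eq, ENNReal.ofReal_mul (by positivity),
          ENNReal.ofReal_mul (by positivity), ENNReal.ofReal_toReal hωt, ENNReal.ofReal_natCast]
        ring
    _ ≤ _ := by
        gcongr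
        exact hN₃.trans (by exact_mod_cast le_max_right _ _)

/-- Lower mass bounds of slabs at the points of `F` which carry an atom. -/
theorem ae_le_measure_slab {n m : ℕ} {V : Gr n m} {μ : Measure (E n)} [IsFiniteMeasure μ]
    {κ : Kernel V.plane (E n)} (hκ : IsDisintegration V μ κ) {F : Set (E n)}
    (hF : MeasurableSet F) {c : ℝ≥0∞} (hct : c ≠ ∞) :
    ∀ᵐ y ∂(μH[m] : Measure V.plane), ∀ x ∈ F, proj V x = y →
      c < (projMeasure V μ).rnDeriv μH[m] y * κ y {x} →
      ∃ N : ℕ, ∀ ρ : ℝ, 0 < ρ → ρ < 1 / (N + 1) →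
        ENNReal.ofReal ((c * (μH[m] : Measure V.plane) (Metric.ball 0 1)).toReal * ρ ^ m)
          ≤ μ (F ∩ {w | ‖V.plane.starProjection (w - x)‖ ≤ ρ}) := by
  have := hκ.isMarkov
  set H : Measure V.plane := μH[m] with hH
  set g : V.plane → ℝ≥0∞ := fun y => (projMeasure V μ).rnDeriv H y * κ y F with hg
  have hgm : Measurable g := (Measure.measurable_rnDeriv _ _).mul (κ.measurable_coe hF)
  have hle := withDensity_le_projMeasure hκ H hF
  have hfin : IsFiniteMeasure (H.withDensity g) := isFiniteMeasure_of_le _ hle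
  filter_upwards [Besicovitch.ae_tendsto_rnDeriv (H.withDensity g) H,
    Measure.rnDeriv_withDensity H hgm] with y hy hyg x hxF hxy hcx
  rw [hyg] at hy
  -- The atom at `x ∈ F` alone bounds the density of the projection of `μ` restricted to `F`,
  -- however small `F` is.
  have hcg : c < g y := hcx.trans_le (by
    simp only [hg]
    gcongr
    exact singleton_subset_iff.2 hxF)
  obtain ⟨u, hu, hu'⟩ := mem_nhdsGT_iff_exists_Ioo_subset.1 (hy.eventually (lt_mem_nhds hcg))
  obtain ⟨N, hN⟩ := exists_nat_one_div_lt (mem_Ioi.1 hu)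
  refine ⟨N, fun ρ hρ hρN => ?_⟩
  have h1 : c < H.withDensity g (Metric.closedBall y ρ) / H (Metric.closedBall y ρ) :=
    hu' ⟨hρ, hρN.trans hN⟩
  have h2 : c * H (Metric.closedBall y ρ) ≤ H.withDensity g (Metric.closedBall y ρ) :=
    (ENNReal.le_div_iff_mul_le (Or.inl (Metric.measure_closedBall_pos H y hρ).ne')
      (Or.inl measure_closedBall_lt_top.ne)).1 h1.le
  calc ENNReal.ofReal ((c * H (Metric.ball 0 1)).toReal * ρ ^ m)
      = c * H (Metric.closedBall y ρ) := by
        rw [addHaar_closedBall_eq H y hρ.le, V.finrank_eq, ENNReal.ofReal_mul (by positivity),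
          ENNReal.ofReal_toReal (ENNReal.mul_ne_top hct measure_ball_lt_top.ne)]
        ring
    _ ≤ projMeasure V (μ.restrict F) (Metric.closedBall y ρ) := h2.trans (hle _)
    _ = μ (F ∩ {w | ‖V.plane.starProjection (w - x)‖ ≤ ρ}) := by
        rw [projMeasure, Measure.map_apply (continuous_proj V).measurable
          Metric.isClosed_closedBall.measurableSet, Measure.restrict_apply
          ((continuous_proj V).measurable Metric.isClosed_closedBall.measurableSet), inter_comm]
        congr 2
        ext w
        rw [mem_preimage, mem_closedBall_iff_norm, ← hxy, norm_proj_sub]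
        rfl

theorem le_norm_of_mem_closure {X : Type*} [NormedAddCommGroup X] [NormedSpace ℝ X]
    (p : X →L[ℝ] X) {S : Set X} {s : ℝ}
    (h : ∀ x ∈ S, ∀ z ∈ S, s * ‖z - x‖ ≤ ‖p (z - x)‖) :
    ∀ x ∈ closure S, ∀ z ∈ closure S, s * ‖z - x‖ ≤ ‖p (z - x)‖ := by
  intro x hx z hz
  have h1 : Continuous fun q : X × X => s * ‖q.2 - q.1‖ := by fun_prop
  have h2 : Continuous fun q : X × X => ‖p (q.2 - q.1)‖ := by fun_prop
  have hmem : (x, z) ∈ closure (S ×ˢ S) := by rw [closure_prod_eq]; exact mk_mem_prod hx hz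
  exact le_on_closure (f := fun q : X × X => s * ‖q.2 - q.1‖)
    (g := fun q : X × X => ‖p (q.2 - q.1)‖) (fun q hq => h q.1 hq.1 q.2 hq.2)
    h1.continuousOn h2.continuousOn hmem

/-! ### Rectifiable pieces and singular projections -/

/-- If the thin cones with vertices in `G` have small mass, and the parts of `G` have mass of the
order of their width in slabs, then `G` meets a rectifiable set in positive measure. -/
theorem exists_rectifiable_inter {n m : ℕ} {V : Gr n m} {μ : Measure (E n)}
    {G : Set (E n)} (hG : MeasurableSet G) (hpos : μ G ≠ 0)
    (hthin : ∀ x ∈ G, ThinCone m μ (cone V.plane.starProjection x)) {c : ℝ} (hcpos : 0 < c)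
    (hlow : ∀ F, MeasurableSet F → F ⊆ G → ∀ᵐ x ∂μ, x ∈ F → ∃ N : ℕ, ∀ ρ : ℝ, 0 < ρ →
      ρ < 1 / (N + 1) → ENNReal.ofReal (c * ρ ^ m)
        ≤ μ (F ∩ {w | ‖V.plane.starProjection (w - x)‖ ≤ ρ})) :
    ∃ C, CountablyRectifiable m C ∧ μ (G ∩ C) ≠ 0 := by
  obtain ⟨l, hl⟩ := exists_nat_one_div_lt (show 0 < c / (2 * 48 ^ m) by positivity)
  set F : ℕ → Set (E n) := fun j => G ∩ {x | ∀ r s : ℝ, 0 < r → r < 1 / (j + 1) → 0 < s →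
    s < 1 / (j + 1) →
      μ (cone V.plane.starProjection x r s) ≤ ENNReal.ofReal (1 / (l + 1) * (r * s) ^ m)} with hFdef
  obtain ⟨j, hj⟩ : ∃ j, μ (F j) ≠ 0 := exists_pos_measure_of_subset_iUnion hpos
    (Eventually.of_forall fun x hx => by
      obtain ⟨j, hj⟩ := hthin x hx l
      exact ⟨j, hx, hj⟩)
  have hFm : MeasurableSet (F j) := by
    refine (hG).inter (IsClosed.measurableSet ?_)
    simp only [ofPred_forall]
    exact isClosed_iInter fun r => isClosed_iInter fun s => isClosed_iInter fun _ =>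
      isClosed_iInter fun _ => isClosed_iInter fun _ => isClosed_iInter fun _ =>
      isClosed_measure_slice_le μ (isOpen_cone V.plane.starProjection r s) _
  -- A point all of whose neighbourhoods charge `F j`, so that localising to a small ball keeps
  -- positive mass.
  obtain ⟨x₀, -, hx₀⟩ := exists_mem_forall_mem_nhdsWithin_pos_measure hj
  set η : ℝ := 1 / (8 * (j + 1)) with hη
  have hη0 : 0 < η := by positivity
  set F₁ := F j ∩ Metric.ball x₀ η with hF₁
  have hF₁m : MeasurableSet F₁ := hFm.inter Metric.isOpen_ball.measurableSet
  have hF₁pos : μ F₁ ≠ 0 := by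
    refine (hx₀ F₁ ?_).ne'
    exact inter_mem_nhdsWithin (F j) (Metric.ball_mem_nhds x₀ hη0)
  -- The lower bound is needed for the localised piece `F₁` itself, which is why `hlow` ranges over
  -- all measurable subsets of `G`.
  obtain ⟨N, hN⟩ : ∃ N : ℕ, μ (F₁ ∩ {x | ∀ ρ : ℝ, 0 < ρ → ρ < 1 / (N + 1) →
      ENNReal.ofReal (c * ρ ^ m) ≤ μ (F₁ ∩ {w | ‖V.plane.starProjection (w - x)‖ ≤ ρ})}) ≠ 0 := by
    refine exists_pos_measure_of_subset_iUnion hF₁pos ?_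
    filter_upwards [hlow F₁ hF₁m fun x hx => hx.1.1] with x hx hxF
    obtain ⟨N, hN⟩ := hx hxF
    exact ⟨N, hxF, hN⟩
  set F₂ := F₁ ∩ {x | ∀ ρ : ℝ, 0 < ρ → ρ < 1 / (N + 1) →
      ENNReal.ofReal (c * ρ ^ m) ≤ μ (F₁ ∩ {w | ‖V.plane.starProjection (w - x)‖ ≤ ρ})} with hF₂
  -- Small enough that `2 s < 1 / (j + 1)` and `s < 1 / (N + 1)`; likewise `η` gives `6 η < 1 / (j +
  -- 1)`.
  set s : ℝ := 1 / (4 * ((j + 1) * (N + 1))) with hs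
  have hs0 : 0 < s := by positivity
  have hj1 : (1 : ℝ) ≤ j + 1 := by simp
  have hN1 : (1 : ℝ) ≤ N + 1 := by simp
  have hjη : η = 1 / 8 * (1 / (j + 1)) := by rw [hη]; field_simp
  have hj2 : (0 : ℝ) < 1 / (j + 1) := by positivity
  have hj3 : (1 : ℝ) / (j + 1) ≤ 1 := by rw [div_le_one (by positivity)]; exact hj1
  have hN2 : (0 : ℝ) < 1 / (N + 1) := by positivity
  have hN3 : (1 : ℝ) / (N + 1) ≤ 1 := by rw [div_le_one (by positivity)]; exact hN1
  have hs' : s = 1 / 4 * (1 / (j + 1)) * (1 / (N + 1)) := by rw [hs]; field_simp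
  have hdiam : ∀ y ∈ F₁, ∀ z ∈ F₁, ‖z - y‖ ≤ 2 * η := by
    intro y hy z hz
    have h1 : dist y x₀ < η := hy.2
    have h2 : dist z x₀ < η := hz.2
    rw [← dist_eq_norm]
    linarith [dist_triangle_right z y x₀]
  have hlip : ∀ x ∈ F₂, ∀ z ∈ F₁, s * ‖z - x‖ ≤ ‖V.plane.starProjection (z - x)‖ := by
    intro x hx
    refine le_norm_of_small_cones (fun y hy r σ => hy.1.2 r σ) hx.1 hx.2 hdiam ?_ ?_ hs0 ?_ ?_
      (by positivity) ?_
    · rw [hjη]; linarith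
    · rw [hjη]; linarith
    · rw [hs']; nlinarith
    · rw [hs']; nlinarith
    · rw [lt_div_iff₀ (by positivity)] at hl
      linarith
  -- `F₂` need not be measurable; its closure is, and inherits the inequality.
  have hclosed := le_norm_of_mem_closure V.plane.starProjection
    fun x hx z hz => hlip x hx z (inter_subset_left hz)
  have hbdd : Bornology.IsBounded (closure F₂) :=
    (Metric.isBounded_ball.subset fun x hx => hx.1.2 : Bornology.IsBounded F₂).closure
  refine ⟨closure F₂, countablyRectifiable_of_le_norm V isClosed_closure hbdd hs0 hclosed,
    fun h => hN (measure_mono_null (fun x (hx : x ∈ F₂) => mem_inter hx.1.1.1 (subset_closure hx)) h)⟩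

/-- On a set carrying no rectifiable mass, atomic slices and thin cones around the fibres force
the projection to be singular. -/
theorem mutuallySingular_projMeasure {n m : ℕ} {V : Gr n m} {μ : Measure (E n)}
    [IsFiniteMeasure μ] (hV : HasAtomicSlices V μ)
    (hcone : ∀ᵐ x ∂μ, ThinConesAt m μ x V.plane.starProjection) {A : Set (E n)}
    (hA : MeasurableSet A) (hR : ∀ R, CountablyRectifiable m R → μ (A ∩ R) = 0) :
    projMeasure V (μ.restrict A) ⟂ₘ (μH[m] : Measure V.plane) := by
  obtain ⟨κ, hκ, hat⟩ := hV
  have := hκ.isMarkov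
  set H : Measure V.plane := μH[m] with hH
  set P := projMeasure V μ with hP
  set f := P.rnDeriv H with hf
  -- `Z` is `ℋᵐ`-conull and misses the singular part, so on `Z` the measure `P` has density `f`. It
  -- suffices that `A` has no mass over `Z`.
  obtain ⟨Z, hZ, hZs, hZH⟩ := Measure.mutuallySingular_singularPart P H
  have hrestr : P.restrict Z = (H.withDensity f).restrict Z := by
    conv_lhs => rw [Measure.haveLebesgueDecomposition_add P H, Measure.restrict_add,
      Measure.restrict_eq_zero.2 hZs, zero_add]
  have hlift : ∀ Q : V.plane → Prop, (∀ᵐ y ∂H, Q y) → ∀ᵐ y ∂P, y ∈ Z → Q y := by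
    intro Q hQ
    rw [← ae_restrict_iff' hZ, hrestr]
    exact ae_restrict_of_ae ((withDensity_absolutelyContinuous H f).ae_le hQ)
  have hpull : ∀ Q : V.plane → Prop, (∀ᵐ y ∂P, Q y) → ∀ᵐ x ∂μ, Q (proj V x) := fun Q hQ =>
    ae_of_ae_map (continuous_proj V).measurable.aemeasurable hQ
  have hfpos : ∀ᵐ y ∂P, y ∈ Z → f y ≠ 0 := by
    rw [← ae_restrict_iff' hZ, hrestr]
    refine ae_restrict_of_ae ?_
    rw [ae_withDensity_iff (Measure.measurable_rnDeriv _ _)]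
    exact Eventually.of_forall fun y hy => hy
  have hatom := ae_atom_ne_zero hκ hZ (hlift _ hat)
  suffices hnull : μ (A ∩ proj V ⁻¹' Z) = 0 by
    refine ⟨Z, hZ, ?_, hZH⟩
    rw [projMeasure, Measure.map_apply (continuous_proj V).measurable hZ,
      Measure.restrict_apply ((continuous_proj V).measurable hZ), inter_comm]
    exact hnull
  by_contra hpos
  have hmeasF : Measurable fun x => f (proj V x) * κ (proj V x) {x} :=
    ((Measure.measurable_rnDeriv _ _).comp (continuous_proj V).measurable).mul
      (measurable_atom V κ)
  -- The points over `Z` with thin cones and a quantitative lower bound for density times atom; they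
  -- exhaust `A ∩ proj V ⁻¹' Z` up to a null set.
  set G : ℕ → Set (E n) := fun i => (A ∩ proj V ⁻¹' Z) ∩
    {x | ((i : ℝ≥0∞) + 1)⁻¹ < f (proj V x) * κ (proj V x) {x}} ∩
    {x | ThinCone m μ (cone V.plane.starProjection x)} with hG
  have hGm : ∀ i, MeasurableSet (G i) := fun i =>
    (((hA.inter ((continuous_proj V).measurable hZ)).inter
      (measurableSet_lt measurable_const hmeasF)).inter
      (measurableSet_thinCone m μ _ (isOpen_cone V.plane.starProjection)))
  obtain ⟨i, hi⟩ : ∃ i, μ (G i) ≠ 0 := by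
    refine exists_pos_measure_of_subset_iUnion hpos ?_
    filter_upwards [hatom, hpull _ hfpos, hcone, hpull _ (hlift _ (ae_tubeBound V μ))]
      with x hx1 hx2 hx3 hx4 hxA
    have hprod : f (proj V x) * κ (proj V x) {x} ≠ 0 := mul_ne_zero (hx2 hxA.2) (hx1 hxA.2)
    obtain ⟨i, hi⟩ := ENNReal.exists_inv_nat_lt hprod
    refine ⟨i, ⟨hxA, lt_of_le_of_lt ?_ hi⟩, hx3 (hx4 hxA.2 x rfl)⟩
    gcongr
    exact le_self_add
  set c₀ : ℝ≥0∞ := ((i : ℝ≥0∞) + 1)⁻¹ with hc₀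
  have hc₀0 : c₀ ≠ 0 := by simp [hc₀]
  have hc₀t : c₀ ≠ ∞ := by simp [hc₀]
  set c : ℝ := (c₀ * H (Metric.ball 0 1)).toReal with hc
  have hcpos : 0 < c := ENNReal.toReal_pos
    (mul_ne_zero hc₀0 (Metric.measure_ball_pos H _ one_pos).ne')
    (ENNReal.mul_ne_top hc₀t measure_ball_lt_top.ne)
  obtain ⟨C, hC, hGC⟩ := exists_rectifiable_inter (hGm i) hi (fun x hx => hx.2) hcpos
    fun F hF hFG => by
      filter_upwards [hpull _ (hlift _ (ae_le_measure_slab hκ hF hc₀t))] with x hx hxF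
      exact hx (hFG hxF).1.1.2 x hxF rfl (hFG hxF).1.2
  exact hGC (measure_mono_null (t := A ∩ C) (fun x hx => ⟨hx.1.1.1.1, hx.2⟩) (hR C hC))

/-! ### Exhaustion, null sets and the decomposition -/

/-- A class of measurable sets closed under countable unions has an element of maximal measure. -/
theorem exists_maximal_measure {X : Type*} [MeasurableSpace X] (μ : Measure X) [IsFiniteMeasure μ]
    {𝒞 : Set X → Prop} (hmeas : ∀ R, 𝒞 R → MeasurableSet R) (hempty : 𝒞 ∅)
    (hUnion : ∀ R : ℕ → Set X, (∀ k, 𝒞 (R k)) → 𝒞 (⋃ k, R k)) :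
    ∃ R, 𝒞 R ∧ ∀ R', 𝒞 R' → μ (R' \ R) = 0 := by
  obtain ⟨u, -, hu, hu'⟩ := exists_seq_tendsto_sSup (S := μ '' {R | 𝒞 R}) ⟨_, ∅, hempty, rfl⟩
    (OrderTop.bddAbove _)
  choose R hR hRu using hu'
  refine ⟨⋃ k, R k, hUnion R hR, fun R' hR' => ?_⟩
  have h1 : sSup (μ '' {R | 𝒞 R}) ≤ μ (⋃ k, R k) := le_of_tendsto' hu fun k => by
    rw [← hRu k]; exact measure_mono (subset_iUnion R k)
  have h2 : 𝒞 ((⋃ k, R k) ∪ R') := by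
    have := hUnion (fun k => if k = 0 then ⋃ k, R k else R') fun k => by
      by_cases hk : k = 0
      · simpa [hk] using hUnion R hR
      · simpa [hk] using hR'
    convert this using 1
    refine Subset.antisymm (union_subset ?_ ?_) (iUnion_subset fun k => ?_)
    · exact subset_iUnion_of_subset 0 (by simp)
    · exact subset_iUnion_of_subset 1 (by simp)
    · by_cases hk : k = 0
      · simp only [hk, if_true]; exact subset_union_left
      · simp only [hk, if_false]; exact subset_union_right
  -- The union already attains the supremum, so adding `R'` gains nothing; finiteness of `μ` permits
  -- the cancellation.
  have h3 : μ (⋃ k, R k) + μ (R' \ ⋃ k, R k) ≤ μ (⋃ k, R k) + 0 := by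
    rw [← measure_union disjoint_sdiff_right ((hmeas _ hR').diff (hmeas _ (hUnion R hR))),
      union_sdiff_self, add_zero]
    exact (le_sSup (mem_image_of_mem μ h2)).trans h1
  exact le_antisymm ((ENNReal.add_le_add_iff_left (measure_ne_top μ _)).1 h3) bot_le

theorem countablyRectifiable_empty (n m : ℕ) : CountablyRectifiable m (∅ : Set (E n)) :=
  ⟨MeasurableSet.empty, fun _ => ∅, fun _ _ => 0, fun _ => Bornology.isBounded_empty,
    fun _ => ⟨0, fun _ h => h.elim⟩, by simp⟩

theorem CountablyRectifiable.iUnion {n m : ℕ} {R : ℕ → Set (E n)}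
    (h : ∀ k, CountablyRectifiable m (R k)) : CountablyRectifiable m (⋃ k, R k) := by
  choose hR A f hA hf hAf using h
  refine ⟨MeasurableSet.iUnion hR, fun k => A k.unpair.1 k.unpair.2,
    fun k => f k.unpair.1 k.unpair.2, fun k => hA _ _, fun k => hf _ _, ?_⟩
  rw [iUnion_unpair fun i j => f i j '' A i j]
  exact iUnion_congr hAf

/-- The projection of a measure carried by an `ℋᵐ`-null set is singular. -/
theorem mutuallySingular_projMeasure_of_null {n m : ℕ} (V : Gr n m) (μ : Measure (E n))
    {N : Set (E n)} (hN : MeasurableSet N) (hN0 : (μH[m] : Measure (E n)) N = 0) :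
    projMeasure V (μ.restrict N) ⟂ₘ (μH[m] : Measure V.plane) := by
  have h0 : (μH[m] : Measure V.plane) (proj V '' N) = 0 := by
    have := (lipschitzWith_proj V).hausdorffMeasure_image_le (d := m) (by positivity) N
    rw [hN0, mul_zero] at this
    exact le_antisymm this bot_le
  refine (Measure.MutuallySingular.mk (s := (toMeasurable μH[m] (proj V '' N))ᶜ)
    (t := toMeasurable μH[m] (proj V '' N)) ?_ ?_ (by simp))
  · rw [projMeasure, Measure.map_apply (continuous_proj V).measurable
      (measurableSet_toMeasurable _ _).compl, Measure.restrict_apply' hN]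
    convert measure_empty (μ := μ)
    refine Set.eq_empty_of_forall_notMem fun x hx => hx.1 ?_
    exact subset_toMeasurable _ _ (mem_image_of_mem _ hx.2)
  · rw [measure_toMeasurable, h0]

end BesicovitchFederer

open BesicovitchFederer in
theorem theorem1p4 (n m : ℕ) (hm : 0 < m) (hmn : m < n)
    (μ : Measure (EuclideanSpace ℝ (Fin n))) [IsFiniteMeasure μ]
    (S : Set (Gr n m)) (hS : MeasurableSet S)
    (hatom : ∀ᵐ V ∂(grassmannMeasure n m hmn.le), V ∈ S → HasAtomicSlices V μ) :
    ∃ μr μu : Measure (EuclideanSpace ℝ (Fin n)),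
      μ = μr + μu ∧ μr ⟂ₘ μu ∧ RectifiableMeasure m μr ∧
        ∀ᵐ V ∂(grassmannMeasure n m hmn.le), V ∈ S → projMeasure V μu ⟂ₘ (μH[m] : Measure V.plane) := by
  obtain ⟨R, hR, hRmax⟩ := exists_maximal_measure μ
    (fun (R : Set (E n)) (h : CountablyRectifiable m R) => h.1) (countablyRectifiable_empty n m)
    fun _ => CountablyRectifiable.iUnion
  -- Removing `N` makes the rest of `μ` absolutely continuous: every `ℋᵐ`-null set lies in `N` up to
  -- `μ`-measure zero.
  obtain ⟨N, ⟨hN, hN0⟩, hNmax⟩ := exists_maximal_measure μ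
    (𝒞 := fun N : Set (E n) => MeasurableSet N ∧ (μH[m] : Measure (E n)) N = 0)
    (fun N h => h.1) ⟨MeasurableSet.empty, measure_empty⟩
    fun N h => ⟨MeasurableSet.iUnion fun k => (h k).1, measure_iUnion_null fun k => (h k).2⟩
  have hRN : MeasurableSet (R \ N) := hR.1.diff hN
  refine ⟨μ.restrict (R \ N), μ.restrict (R \ N)ᶜ, (Measure.restrict_add_restrict_compl hRN).symm,
    ?_, ⟨inferInstance, ?_, R, hR, ?_⟩, ?_⟩
  · refine Measure.MutuallySingular.mk (s := (R \ N)ᶜ) (t := R \ N) ?_ ?_ (by simp)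
    · rw [Measure.restrict_apply hRN.compl, compl_inter_self, measure_empty]
    · rw [Measure.restrict_apply hRN, inter_compl_self, measure_empty]
  · refine Measure.AbsolutelyContinuous.mk fun B hB hB0 => ?_
    rw [Measure.restrict_apply hB]
    exact measure_mono_null (t := B \ N) (fun x hx => ⟨hx.1, hx.2.2⟩) (hNmax B ⟨hB, hB0⟩)
  · rw [Measure.restrict_apply hR.1.compl]
    exact measure_mono_null (fun x hx => hx.1 hx.2.1) (measure_empty (μ := μ))
  · filter_upwards [hatom, ae_thinConesAt hm hmn.le μ] with V hV hthin hVS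
    -- By maximality of `R`, no rectifiable set has mass in `Rᶜ`.
    have h1 : projMeasure V (μ.restrict Rᶜ) ⟂ₘ (μH[m] : Measure V.plane) :=
      mutuallySingular_projMeasure (hV hVS) hthin hR.1.compl fun R' hR' => by
        rw [inter_comm]; exact hRmax R' hR'
    have h2 := mutuallySingular_projMeasure_of_null V μ hN hN0
    refine (h2.add_left h1).mono ?_ le_rfl
    have hsub : (R \ N)ᶜ ⊆ N ∪ Rᶜ := fun x hx => by
      by_cases hxN : x ∈ N
      · exact Or.inl hxN
      · exact Or.inr fun hxR => hx ⟨hxR, hxN⟩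
    have hm' := (continuous_proj V).measurable
    rw [projMeasure, projMeasure, projMeasure, ← Measure.map_add _ _ hm']
    exact Measure.map_mono ((Measure.restrict_mono hsub le_rfl).trans
      (Measure.restrict_union_le _ _)) hm'
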